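/- Let $p$ be a prime number and let $R$ be an integral domain which is torsion free as an abelian group, such that the natural map $R\to\varprojlim_n R/p^nR$ is an isomorphism, and which is equipped with a lift of Frobenius, i.e. a ring endomorphism $F:R\to R$ with $F(r)\equiv r^p \bmod pR$ for all $r\in R$. Let $N$ be the field of fractions of $R$, let $G$ be a finite $p$-group, let $G^{\mathrm{ab}}$ be its abelianization and $C_G$ its set of conjugacy classes. Let $I(R[G])$ be the kernel of the augmentation map $R[G]\to R$, let $\mathcal A(R[G])$ be the kernel of the natural map $R[G]\to R[G^{\mathrm{ab}}]$, let $\phi$ denote the linear maps $R[G]\to R[C_G]$ and $N[G]\to N[C_G]$ sending each group element to its conjugacy class, and let $\Psi:R[G]\to R[G]$ be the $F$-semilinear map with $\Psi(rg)=F(r)g^p$ for $r\in R$, $g\in G$. Then for every $x\in I(R[G])$ each of the series $\sum_{n\ge1}\frac{p\,x^n}{n}$ and $\sum_{n\ge 1}\frac{\Psi(x^n)}{n}$ has a unique sum in $N[G]$ for the $p$-adic topology (in which the subgroups $p^kR[G]$, $k\ge0$, form a basis of neighbourhoods of $0$), so that the group logarithm $$\mathcal L:1+I(R[G])\to N[C_G],\qquad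 \mathcal L(1-x)=-\phi\Big(\sum_{n\ge1}\frac{p\,x^n}{n}-\sum_{n\ge1}\frac{\Psi(x^n)}{n}\Big),$$ is well defined; and, viewing $R[C_G]$ as a subset of $N[C_G]$, $$\mathcal L\big(1+\mathcal A(R[G])\big)=p\,\phi\big(\mathcal A(R[G])\big).$$ -/

import Mathlib

open scoped MonoidAlgebra

noncomputable section

namespace GroupLog

section Definitions

variable (R : Type*) [CommRing R] (G : Type*) [Group G]

/-- The augmentation ideal `I(R[G])`: the kernel of `R[G] → R`, `∑ r_g g ↦ ∑ r_g`. -/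
def augIdeal : Ideal R[G] :=
  RingHom.ker (MonoidAlgebra.lift R R G (1 : G →* R))

/-- `𝒜(R[G])`: the kernel of the natural ring homomorphism `R[G] → R[Gᵃᵇ]`. -/
def abKernel : Ideal R[G] :=
  RingHom.ker (MonoidAlgebra.mapDomainRingHom R (Abelianization.of : G →* Abelianization G))

/-- The `R`-linear map `φ : R[G] → R[C_G]` sending each group element to its conjugacy class;
`R[C_G]` is the free `R`-module on the set `C_G` of conjugacy classes of `G`. -/
def phi : R[G] →ₗ[R] (ConjClasses G →₀ R) :=
  Finsupp.lmapDomain R R (ConjClasses.mk : G → ConjClasses G) ∘ₗ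
    (MonoidAlgebra.coeffLinearEquiv R).toLinearMap

variable {R} {G}

/-- The `F`-semilinear map `Ψ : R[G] → R[G]`, `Ψ (r g) = F(r) g ^ p`. -/
def psi (p : ℕ) (F : R →+* R) : R[G] →+ R[G] :=
  (Finsupp.liftAddHom fun g : G =>
    (MonoidAlgebra.singleAddHom (g ^ p)).comp F.toAddMonoidHom).comp
    (MonoidAlgebra.coeffAddEquiv : R[G] ≃+ (G →₀ R)).toAddMonoidHom

variable (N : Type*) [Field N] [Algebra R N]

/-- The natural map `R[G] → N[G]`. -/
def toFrac : R[G] →+* N[G] :=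
  MonoidAlgebra.mapRingHom G (algebraMap R N)

/-- The natural map `R[C_G] → N[C_G]`. -/
def toFracClass : (ConjClasses G →₀ R) →ₗ[R] (ConjClasses G →₀ N) :=
  Finsupp.mapRange.linearMap (Algebra.linearMap R N)

variable {N}

variable (R) in
/-- `∑_{n ≥ 0} f n = s` in `N[G]` for the `p`-adic topology, in which the subgroups
`p ^ k R[G]`, `k ≥ 0`, form a basis of neighbourhoods of `0`. -/
def HasPadicSum (p : ℕ) (f : ℕ → N[G]) (s : N[G]) : Prop :=
  ∀ k : ℕ, ∀ᶠ m in Filter.atTop, ∃ r : R[G],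
    (∑ n ∈ Finset.range m, f n) - s = toFrac N ((p : R[G]) ^ k * r)

open Classical in
variable (R) in
/-- The sum of a `p`-adically convergent series in `N[G]` (and `0` if there is no sum). -/
def padicSum (p : ℕ) (f : ℕ → N[G]) : N[G] :=
  if h : ∃ s, HasPadicSum R p f s then h.choose else 0

variable (N)

/-- The terms of the series `∑_{n ≥ 1} p x ^ n / n = - p log (1 - x)`; the term with index `n`
here belongs to the exponent `n + 1`. -/
def logTerm (p : ℕ) (x : R[G]) (n : ℕ) : N[G] :=
  ((p : N) / ((n + 1 : ℕ) : N)) • toFrac N (x ^ (n + 1))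

/-- The terms of the series `∑_{n ≥ 1} Ψ(x ^ n) / n = - Ψ (log (1 - x))`; the term with index
`n` here belongs to the exponent `n + 1`. -/
def psiLogTerm (p : ℕ) (F : R →+* R) (x : R[G]) (n : ℕ) : N[G] :=
  (1 / ((n + 1 : ℕ) : N)) • toFrac N (psi p F (x ^ (n + 1)))

/-- The group logarithm
`ℒ(1 - x) = - φ (∑_{n ≥ 1} p x ^ n / n - ∑_{n ≥ 1} Ψ(x ^ n) / n) ∈ N[C_G]`,
as a function of `u = 1 - x`. It is meaningful for `u ∈ 1 + I(R[G])`. -/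
def groupLog (p : ℕ) (F : R →+* R) (u : R[G]) : ConjClasses G →₀ N :=
  -phi N G (padicSum R p (logTerm N p (1 - u)) - padicSum R p (psiLogTerm N p F (1 - u)))

end Definitions

end GroupLog

end

/-!
The group logarithm is governed by the single additive map `λ = p φ - φ ∘ Ψ : R[G] → R[C_G]`, which
is a trace (`λ(a b) = λ(b a)`), since `ℒ(1 - x) = - ∑ λ(x ^ n) / n`. Convergence for `x` in the
augmentation ideal `I` holds because `I` is nilpotent modulo `p` when `G` is a finite `p`-group
(`exists_augIdeal_pow_le`), so that `x ^ n` is divisible by a power of `p` growing linearly in `n`,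
against a logarithmic growth of the denominators.

The inclusion `ℒ(1 + 𝒜) ⊆ p φ(𝒜)` rests on the congruence
`φ(y ^ (p ^ (s + 1))) ≡ φ(Ψ(y ^ (p ^ s)))` modulo `p ^ (s + 1)` (`phi_pow_sub_phi_psi_mem`), proved
by expanding powers into words and grouping the words along orbits of rotation. It gives
`ℒ(1 + I) ⊆ p R[C_G]`. By functoriality the value at an element of `1 + 𝒜` dies in the group ring of
the abelianization, and an element of `R[C_G]` that dies there lies in `φ(𝒜)`.

The reverse inclusion is proved by induction on the order of `G`. A nonabelian `G` has a central
commutator `z` of order `p`. The claim for `G ⧸ ⟨z⟩` yields an `x` in `𝒜` for which `ℒ(1 - x)` is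
the given value up to an element of `p φ((1 - z) R[G])`. Since `z` is a commutator, `z g` is
conjugate to `g` for some `g`, and the error even lies in `p φ((1 - z) I)`
(`exists_mem_augIdeal_phi_eq`). Here `Ψ` vanishes on `(1 - z) R[G]`, and `(1 - z) ^ n` is divisible
by `n (1 - z)`, so that `- ℒ(1 - (1 - z) q) = p φ((1 - z) f(q))` for a power series
`f(q) = q + c₁ q² + ⋯` with coefficients in `R[G]`; such a series maps `I` onto `I`
(`exists_powerSeries_eq`). As `ℒ` turns products into sums (`HasLogSum.mul`), multiplying `1 - x` by
a suitable `1 - (1 - z) q` removes the error. Additivity comes from the formal identity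
`trace_log_mul` for `log ((1 - t x) (1 - t y))`, whose derivative in `t` is computed under a trace,
evaluated at `t = 1`.
-/

noncomputable section

namespace GroupLog

open Filter

/-! ### Series in a group with a lattice -/

section PadicSummation

variable {V W : Type*} [AddCommGroup V] [AddCommGroup W]

/-- The subgroup `p ^ k Λ` of `V`; these are the basic neighbourhoods of `0` for the `p`-adic
topology on `V` defined by the lattice `Λ`. -/
def padicNhd (p : ℕ) (Λ : AddSubgroup V) (k : ℕ) : AddSubgroup V :=
  Λ.map (nsmulAddMonoidHom (p ^ k))

lemma mem_padicNhd {p : ℕ} {Λ : AddSubgroup V} {k : ℕ} {v : V} :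
    v ∈ padicNhd p Λ k ↔ ∃ r ∈ Λ, p ^ k • r = v := by
  simp [padicNhd, AddSubgroup.mem_map]

lemma padicNhd_zero {p : ℕ} {Λ : AddSubgroup V} : padicNhd p Λ 0 = Λ := by
  ext v; simp [mem_padicNhd]

lemma map_mem_padicNhd {p : ℕ} {Λ : AddSubgroup V} {Λ' : AddSubgroup W} (h : V →+ W)
    (hΛ : ∀ v ∈ Λ, h v ∈ Λ') {k : ℕ} {v : V} (hv : v ∈ padicNhd p Λ k) :
    h v ∈ padicNhd p Λ' k := by
  obtain ⟨r, hr, rfl⟩ := mem_padicNhd.1 hv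
  exact mem_padicNhd.2 ⟨h r, hΛ r hr, by simp⟩

/-- The series `∑ f n` converges to `s` for the `p`-adic topology defined by the lattice `Λ`. -/
def SumsTo (p : ℕ) (Λ : AddSubgroup V) (f : ℕ → V) (s : V) : Prop :=
  ∀ k : ℕ, ∀ᶠ m in atTop, (∑ n ∈ Finset.range m, f n) - s ∈ padicNhd p Λ k

/-- The `p`-adic topology defined by the lattice `Λ` is Hausdorff. -/
def PadicSeparated (p : ℕ) (Λ : AddSubgroup V) : Prop :=
  ∀ v, (∀ k, v ∈ padicNhd p Λ k) → v = 0

variable (V) in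
/-- In `V`, with its own `p`-adic topology, every series whose terms tend to `0` converges. -/
def PadicComplete (p : ℕ) : Prop :=
  ∀ a : ℕ → V, (∀ k, ∀ᶠ n in atTop, a n ∈ padicNhd p (⊤ : AddSubgroup V) k) →
    ∃ s, SumsTo p ⊤ a s

variable {p : ℕ} {Λ : AddSubgroup V} {Λ' : AddSubgroup W} {f g : ℕ → V} {s t : V}

lemma SumsTo.map (hf : SumsTo p Λ f s) (h : V →+ W) (hΛ : ∀ v ∈ Λ, h v ∈ Λ') :
    SumsTo p Λ' (fun n => h (f n)) (h s) := by
  intro k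
  filter_upwards [hf k] with m hm
  have := map_mem_padicNhd h hΛ hm
  simpa [map_sub, map_sum] using this

lemma SumsTo.congr (hf : SumsTo p Λ f s) (h : ∀ n, f n = g n) : SumsTo p Λ g s := by
  rwa [← show f = g from funext h]

lemma SumsTo.add (hf : SumsTo p Λ f s) (hg : SumsTo p Λ g t) :
    SumsTo p Λ (fun n => f n + g n) (s + t) := by
  intro k
  filter_upwards [hf k, hg k] with m h1 h2
  rw [Finset.sum_add_distrib, add_sub_add_comm]
  exact add_mem h1 h2

lemma SumsTo.sub (hf : SumsTo p Λ f s) (hg : SumsTo p Λ g t) :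
    SumsTo p Λ (fun n => f n - g n) (s - t) := by
  intro k
  filter_upwards [hf k, hg k] with m h1 h2
  rw [Finset.sum_sub_distrib, sub_sub_sub_comm]
  exact sub_mem h1 h2

lemma SumsTo.unique (hΛ : PadicSeparated p Λ) (hf : SumsTo p Λ f s) (hg : SumsTo p Λ f t) :
    s = t := by
  refine sub_eq_zero.1 (hΛ _ fun k => ?_)
  obtain ⟨m, h1, h2⟩ := ((hf k).and (hg k)).exists
  have := sub_mem h2 h1
  simpa using this

/-- Two series whose partial sums become arbitrarily close have the same sum. -/
lemma SumsTo.of_partialSum_sub (hf : SumsTo p Λ f s)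
    (h : ∀ k, ∀ᶠ m in atTop,
      (∑ n ∈ Finset.range m, g n) - (∑ n ∈ Finset.range m, f n) ∈ padicNhd p Λ k) :
    SumsTo p Λ g s := by
  intro k
  filter_upwards [hf k, h k] with m h1 h2
  have := add_mem h2 h1
  simpa using this

lemma sumsTo_zero : SumsTo p Λ (fun _ => (0 : V)) 0 := by
  intro k
  simp [zero_mem]

/-- A series whose terms tend to `0` converges as soon as the lattice is complete. -/
lemma exists_sumsTo {M : Type*} [AddCommGroup M] (hM : PadicComplete M p) (ι : M →+ V)
    (hι : Function.Injective ι) (hf : ∀ k, ∀ᶠ n in atTop, f n ∈ padicNhd p ι.range k) :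
    ∃ s, SumsTo p ι.range f s := by
  obtain ⟨n₀, hn₀⟩ := eventually_atTop.1 (hf 0)
  simp only [padicNhd_zero] at hn₀
  choose a ha using fun n => hn₀ (n + n₀) (Nat.le_add_left _ _)
  obtain ⟨s, hs⟩ := hM a fun k => by
    filter_upwards [(tendsto_add_atTop_nat n₀).eventually (hf k)] with n hn
    obtain ⟨_, ⟨b, rfl⟩, hb⟩ := mem_padicNhd.1 hn
    refine mem_padicNhd.2 ⟨b, trivial, hι ?_⟩
    rw [map_nsmul, hb, ha]
  have hs' := hs.map (Λ' := ι.range) ι fun v _ => ⟨v, rfl⟩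
  refine ⟨ι s + ∑ n ∈ Finset.range n₀, f n, fun k => ?_⟩
  have := (tendsto_sub_atTop_nat n₀).eventually (hs' k)
  filter_upwards [this, eventually_ge_atTop n₀] with m hm hle
  obtain ⟨l, rfl⟩ := Nat.exists_eq_add_of_le hle
  rw [Finset.sum_range_add]
  simp only [ha, Nat.add_sub_cancel_left] at hm
  simpa only [add_comm n₀, add_sub_add_left_eq_sub, add_comm (ι s)] using hm

lemma padicSeparated_range {M : Type*} [AddCommGroup M] (hM : PadicSeparated p (⊤ : AddSubgroup M))
    (ι : M →+ V) (hι : Function.Injective ι) : PadicSeparated p ι.range := by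
  intro v hv
  have h0 := hv 0
  rw [padicNhd_zero] at h0
  obtain ⟨a, rfl⟩ := h0
  rw [hM a, map_zero]
  intro k
  obtain ⟨_, ⟨b, rfl⟩, hb⟩ := mem_padicNhd.1 (hv k)
  exact mem_padicNhd.2 ⟨b, trivial, hι (by rw [map_nsmul, hb])⟩

end PadicSummation

/-! ### Completeness of free modules of finite rank -/

section Completeness

variable {p : ℕ} {R : Type*} [CommRing R]

lemma mem_padicNhd_top_iff {k : ℕ} {r : R} :
    r ∈ padicNhd p (⊤ : AddSubgroup R) k ↔ r ∈ Ideal.span {(p : R)} ^ k := by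
  rw [Ideal.span_singleton_pow, Ideal.mem_span_singleton, mem_padicNhd]
  constructor
  · rintro ⟨a, -, rfl⟩
    exact ⟨a, by simp⟩
  · rintro ⟨a, rfl⟩
    exact ⟨a, trivial, by simp⟩

lemma padicSeparated_self [IsHausdorff (Ideal.span {(p : R)}) R] :
    PadicSeparated p (⊤ : AddSubgroup R) := by
  intro v hv
  refine IsHausdorff.haus ‹IsHausdorff (Ideal.span {(p : R)}) R› v fun k => ?_
  rw [SModEq.zero, smul_eq_mul, Ideal.mul_top]
  exact mem_padicNhd_top_iff.1 (hv k)

lemma padicComplete_self [IsPrecomplete (Ideal.span {(p : R)}) R] : PadicComplete R p := by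
  intro a ha
  -- `N k` is an index beyond which all terms are divisible by `p ^ k`.
  choose N hN using fun k => eventually_atTop.1 (ha k)
  let S : ℕ → R := fun m => ∑ n ∈ Finset.range m, a n
  have hS : ∀ k m l, N k ≤ m → N k ≤ l → S m - S l ∈ padicNhd p (⊤ : AddSubgroup R) k := by
    intro k m l hm hl
    wlog h : l ≤ m generalizing m l
    · rw [← neg_sub]
      exact neg_mem (this l m hl hm (le_of_not_ge h))
    rw [← Finset.sum_Ico_eq_sub _ h]
    exact sum_mem fun n hn => hN k n (hl.trans (Finset.mem_Ico.1 hn).1)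
  let K : ℕ → ℕ := fun k => (Finset.range (k + 1)).sup N
  have hK : ∀ {i k}, i ≤ k → N i ≤ K k := fun {i k} h =>
    Finset.le_sup (f := N) (Finset.mem_range.2 (by omega))
  obtain ⟨L, hL⟩ := IsPrecomplete.prec ‹IsPrecomplete (Ideal.span {(p : R)}) R›
    (f := fun k => S (K k)) fun {m n} hmn => by
      rw [SModEq.sub_mem, smul_eq_mul, Ideal.mul_top]
      exact mem_padicNhd_top_iff.1 (hS m _ _ (hK le_rfl) (hK hmn))
  refine ⟨L, fun k => ?_⟩
  filter_upwards [eventually_ge_atTop (N k)] with m hm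
  have h1 := hL k
  rw [SModEq.sub_mem, smul_eq_mul, Ideal.mul_top] at h1
  have h2 := add_mem (hS k m (K k) hm (hK le_rfl)) (mem_padicNhd_top_iff.2 h1)
  simpa using h2

variable {X : Type*}

lemma mem_padicNhd_top_finsupp [Finite X] {k : ℕ} {v : X →₀ R} :
    v ∈ padicNhd p (⊤ : AddSubgroup (X →₀ R)) k ↔
      ∀ i, v i ∈ padicNhd p (⊤ : AddSubgroup R) k := by
  constructor
  · intro h i
    exact map_mem_padicNhd (Λ' := ⊤) (Finsupp.applyAddHom i) (fun _ _ => trivial) h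
  · intro h
    choose b _ hb using fun i => mem_padicNhd.1 (h i)
    exact mem_padicNhd.2 ⟨Finsupp.equivFunOnFinite.symm b, trivial, by ext i; simp [← hb]⟩

lemma padicSeparated_finsupp [Finite X] [IsHausdorff (Ideal.span {(p : R)}) R] :
    PadicSeparated p (⊤ : AddSubgroup (X →₀ R)) := by
  intro v hv
  ext i
  exact padicSeparated_self (p := p) _ fun k => mem_padicNhd_top_finsupp.1 (hv k) i

lemma padicComplete_finsupp [Finite X] [IsPrecomplete (Ideal.span {(p : R)}) R] :
    PadicComplete (X →₀ R) p := by
  intro a ha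
  choose s hs using fun i : X => padicComplete_self (p := p) (fun n => a n i) fun k =>
    (ha k).mono fun n hn => mem_padicNhd_top_finsupp.1 hn i
  refine ⟨Finsupp.equivFunOnFinite.symm s, fun k => ?_⟩
  filter_upwards [eventually_all.2 fun i => hs i k] with m hm
  refine mem_padicNhd_top_finsupp.2 fun i => ?_
  simpa [Finsupp.finsetSum_apply] using hm i

lemma mem_padicNhd_of_addEquiv {V W : Type*} [AddCommGroup V] [AddCommGroup W] (e : V ≃+ W)
    {k : ℕ} {v : V} :
    e v ∈ padicNhd p (⊤ : AddSubgroup W) k ↔ v ∈ padicNhd p (⊤ : AddSubgroup V) k := by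
  refine ⟨fun h => ?_, map_mem_padicNhd (Λ' := ⊤) e.toAddMonoidHom fun _ _ => trivial⟩
  simpa using map_mem_padicNhd (Λ' := ⊤) e.symm.toAddMonoidHom (fun _ _ => trivial) h

lemma padicSeparated_monoidAlgebra [Finite X] [IsHausdorff (Ideal.span {(p : R)}) R] :
    PadicSeparated p (⊤ : AddSubgroup R[X]) := by
  intro v hv
  rw [← MonoidAlgebra.coeff_eq_zero]
  exact padicSeparated_finsupp (p := p) _ fun k =>
    (mem_padicNhd_of_addEquiv (MonoidAlgebra.coeffAddEquiv (R := R) (M := X))).2 (hv k)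

lemma padicComplete_monoidAlgebra [Finite X] [IsPrecomplete (Ideal.span {(p : R)}) R] :
    PadicComplete R[X] p := by
  intro a ha
  obtain ⟨s, hs⟩ := padicComplete_finsupp (p := p) (fun n => (a n).coeff) fun k =>
    (ha k).mono fun n hn =>
      (mem_padicNhd_of_addEquiv (MonoidAlgebra.coeffAddEquiv (R := R) (M := X))).2 hn
  exact ⟨_, hs.map (MonoidAlgebra.coeffAddEquiv (R := R) (M := X)).symm.toAddMonoidHom
    fun _ _ => trivial⟩

end Completeness

/-! ### The trace of a logarithm is additive, formally -/

section TraceOfLogarithm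

open Polynomial

/-- A trace `T` kills commutators, so it sees the power rule for a derivation `D` even though
`b` and `D b` need not commute. -/
lemma trace_derivation_pow {B V : Type*} [Ring B] [AddCommGroup V] (T : B →+ V)
    (hT : ∀ a b, T (a * b) = T (b * a)) (D : B → B)
    (hD : ∀ a b, D (a * b) = D a * b + a * D b) (b : B) (n : ℕ) :
    T (D (b ^ (n + 1))) = (n + 1) • T (b ^ n * D b) := by
  -- The extra factor `b ^ j` is what makes the induction work.
  have key : ∀ n j : ℕ, T (b ^ j * D (b ^ (n + 1))) = (n + 1) • T (b ^ (j + n) * D b) := by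
    intro n
    induction n with
    | zero => intro j; simp
    | succ n ih =>
      intro j
      have h1 : T (b ^ j * (D (b ^ (n + 1)) * b)) = T (b ^ (j + 1) * D (b ^ (n + 1))) := by
        rw [← mul_assoc, hT, ← mul_assoc, pow_succ' b j]
      rw [pow_succ b (n + 1), hD, mul_add, map_add, h1, ih, ← mul_assoc, ← pow_add,
        succ_nsmul _ (n + 1)]
      rw [add_right_comm, add_assoc j n 1]
  simpa using key n 0

variable {A : Type*} [Ring A]

/-- The polynomial `W(t) = 1 - (1 - t x) (1 - t y)`. -/
def logPoly (x y : A) : A[X] := C x * X + C y * X - C (x * y) * X ^ 2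

lemma one_sub_logPoly (x y : A) : 1 - logPoly x y = (1 - C x * X) * (1 - C y * X) := by
  have h : C x * X * (C y * X) = C (x * y) * X ^ 2 := by
    rw [mul_assoc, ← mul_assoc X, X_mul_C, C_mul, pow_two]
    simp only [mul_assoc]
  rw [logPoly, mul_sub, sub_mul, sub_mul, h]
  simp only [mul_one, one_mul]
  abel

lemma derivative_logPoly (x y : A) :
    derivative (logPoly x y) = C x * (1 - C y * X) + (1 - C x * X) * C y := by
  have h : C x * X * C y = C x * (C y * X) := by rw [mul_assoc, X_mul_C]
  have h2 : derivative (C (x * y) * X ^ 2 : A[X]) = C x * (C y * X) + C x * (C y * X) := by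
    rw [derivative_C_mul, pow_two, derivative_mul]
    simp [mul_assoc, mul_add]
  rw [mul_sub, sub_mul, h, logPoly, derivative_sub, derivative_add, h2, derivative_C_mul,
    derivative_C_mul]
  simp only [derivative_X, mul_one, one_mul]
  abel

lemma geom_mul_one_sub {B : Type*} [Ring B] (w : B) (M : ℕ) :
    (∑ n ∈ Finset.range M, w ^ n) * (1 - w) = 1 - w ^ M := by
  rw [← neg_sub w 1, mul_neg, geom_sum_mul, neg_sub]

lemma one_sub_mul_geom {B : Type*} [Ring B] (w : B) (M : ℕ) :
    (1 - w) * (∑ n ∈ Finset.range M, w ^ n) = 1 - w ^ M := by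
  rw [← neg_sub w 1, neg_mul, mul_geom_sum, neg_sub]

lemma logPoly_eq (x y : A) : logPoly x y = X * (C x + C y - C (x * y) * X) := by
  rw [X_mul, logPoly, sub_mul, add_mul, pow_two, mul_assoc]

lemma C_mul_X_pow (x : A) (n : ℕ) : (C x * X) ^ n = C (x ^ n) * X ^ n := by
  rw [(commute_X (C x)).symm.mul_pow, C_pow]

variable {V : Type*} [AddCommGroup V] (T : A →+ V)

/-- The additive map `P ↦ T (coeff_m P)`. -/
def coeffTrace (m : ℕ) : A[X] →+ V := T.comp (lcoeff A m).toAddMonoidHom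

lemma coeffTrace_apply (m : ℕ) (P : A[X]) : coeffTrace T m P = T (P.coeff m) := rfl

lemma coeffTrace_comm (hT : ∀ a b, T (a * b) = T (b * a)) (m : ℕ) (P Q : A[X]) :
    coeffTrace T m (P * Q) = coeffTrace T m (Q * P) := by
  rw [coeffTrace_apply, coeffTrace_apply, coeff_mul, coeff_mul, map_sum, map_sum,
    ← Finset.Nat.sum_antidiagonal_swap]
  exact Finset.sum_congr rfl fun _ _ => hT _ _

lemma coeffTrace_X_pow_mul {m M : ℕ} (h : m < M) (P : A[X]) :
    coeffTrace T m (X ^ M * P) = 0 := by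
  rw [coeffTrace_apply, coeff_X_pow_mul', if_neg (by omega), map_zero]

lemma coeffTrace_geom {m M : ℕ} (h : m < M) (y : A) :
    coeffTrace T m ((∑ n ∈ Finset.range M, (C y * X) ^ n) * C y) = T (y ^ (m + 1)) := by
  rw [coeffTrace_apply]
  congr 1
  rw [Finset.sum_mul, finsetSum_coeff, Finset.sum_eq_single m]
  · rw [C_mul_X_pow, coeff_mul_C, coeff_C_mul_X_pow, if_pos rfl, pow_succ]
  · intro n _ hn
    rw [C_mul_X_pow, coeff_mul_C, coeff_C_mul_X_pow, if_neg hn.symm, zero_mul]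
  · intro hm
    exact absurd (Finset.mem_range.2 h) hm

/-- The trace of `(1 - W)⁻¹ W'` is that of `(1 - t x)⁻¹ x + (1 - t y)⁻¹ y`. -/
lemma coeffTrace_geom_logPoly (hT : ∀ a b, T (a * b) = T (b * a)) {m M : ℕ} (h : m < M)
    (x y : A) :
    coeffTrace T m ((∑ n ∈ Finset.range M, logPoly x y ^ n) * derivative (logPoly x y)) =
      T (x ^ (m + 1)) + T (y ^ (m + 1)) := by
  set W := logPoly x y with hW
  set S := ∑ n ∈ Finset.range M, W ^ n with hS
  set Px := ∑ n ∈ Finset.range M, (C x * X : A[X]) ^ n with hPx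
  set Py := ∑ n ∈ Finset.range M, (C y * X : A[X]) ^ n with hPy
  obtain ⟨W₁, hW₁⟩ : ∃ W₁, W ^ M = X ^ M * W₁ :=
    ⟨(C x + C y - C (x * y) * X) ^ M, by
      rw [hW, logPoly_eq, (commute_X _).mul_pow]⟩
  have hX : ∀ z : A, ∀ Q : A[X], Q * (C z * X) ^ M = X ^ M * (Q * C (z ^ M)) := by
    intro z Q
    rw [C_mul_X_pow, ← mul_assoc, X_pow_mul]
  have hSl : S * ((1 - C x * X) * (1 - C y * X)) = 1 - W ^ M := by
    rw [← one_sub_logPoly, geom_mul_one_sub]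
  have hSr : (1 - C x * X) * (1 - C y * X) * S = 1 - W ^ M := by
    rw [← one_sub_logPoly, one_sub_mul_geom]
  have h1 : ∃ Q, S * (1 - C x * X) = Py + X ^ M * Q := by
    have e1 : S * (1 - C x * X) * ((1 - C y * X) * Py) = Py - W ^ M * Py := by
      rw [← mul_assoc, mul_assoc S, hSl, sub_mul, one_mul]
    rw [one_sub_mul_geom, mul_sub, mul_one, hX, hW₁, mul_assoc (X ^ M)] at e1
    refine ⟨S * (1 - C x * X) * C (y ^ M) - W₁ * Py, ?_⟩
    rw [mul_sub (X ^ M)]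
    rw [sub_eq_iff_eq_add] at e1
    nth_rw 1 [e1]
    abel
  have h2 : ∃ Q, (1 - C y * X) * S = Px + X ^ M * Q := by
    have e1 : (Px * (1 - C x * X)) * ((1 - C y * X) * S) = Px - Px * W ^ M := by
      rw [mul_assoc, ← mul_assoc _ _ S, hSr, mul_sub, mul_one]
    rw [geom_mul_one_sub, sub_mul, one_mul, hW₁, ← mul_assoc Px, ← X_pow_mul, mul_assoc (X ^ M),
      C_mul_X_pow, ← X_pow_mul, mul_assoc (X ^ M)] at e1
    refine ⟨C (x ^ M) * ((1 - C y * X) * S) - Px * W₁, ?_⟩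
    rw [mul_sub (X ^ M)]
    rw [sub_eq_iff_eq_add] at e1
    nth_rw 1 [e1]
    abel
  obtain ⟨Q₁, hQ₁⟩ := h1
  obtain ⟨Q₂, hQ₂⟩ := h2
  have c1 : coeffTrace T m (S * (C x * (1 - C y * X))) = T (x ^ (m + 1)) := by
    rw [← mul_assoc, coeffTrace_comm T hT, ← mul_assoc, hQ₂, add_mul, map_add, coeffTrace_geom T h,
      mul_assoc, coeffTrace_X_pow_mul T h, add_zero]
  have c2 : coeffTrace T m (S * ((1 - C x * X) * C y)) = T (y ^ (m + 1)) := by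
    rw [← mul_assoc, hQ₁, add_mul, map_add, coeffTrace_geom T h, mul_assoc,
      coeffTrace_X_pow_mul T h, add_zero]
  rw [hW, derivative_logPoly, mul_add, map_add, c1, c2]

/-- The coefficient of `t ^ (m + 1)` in the trace of
`log ((1 - t x) (1 - t y)) = log (1 - t x) + log (1 - t y)`. -/
lemma trace_log_mul {N : Type*} [Field N] [CharZero N] [Module N V]
    (hT : ∀ a b, T (a * b) = T (b * a)) {m M : ℕ} (h : m < M) (x y : A) :
    ∑ n ∈ Finset.range M,
        (1 / ((n + 1 : ℕ) : N)) • T ((logPoly x y ^ (n + 1)).coeff (m + 1)) =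
      (1 / ((m + 1 : ℕ) : N)) • (T (x ^ (m + 1)) + T (y ^ (m + 1))) := by
  have hcast : ∀ n : ℕ, ((n + 1 : ℕ) : N) ≠ 0 := fun n => Nat.cast_ne_zero.2 n.succ_ne_zero
  rw [← coeffTrace_geom_logPoly T hT h, Finset.sum_mul, map_sum, Finset.smul_sum]
  refine Finset.sum_congr rfl fun n _ => ?_
  have h1 := trace_derivation_pow (coeffTrace T m) (coeffTrace_comm T hT m)
    (fun P => derivative P) (fun a b => by simp [derivative_mul]) (logPoly x y) n
  rw [coeffTrace_apply, coeff_derivative, ← Nat.cast_succ, ← (Nat.cast_commute _ _).eq,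
    ← nsmul_eq_mul, map_nsmul, ← Nat.cast_smul_eq_nsmul N, ← Nat.cast_smul_eq_nsmul N] at h1
  have h2 := congrArg (fun v => (1 / ((m + 1 : ℕ) : N)) • (1 / ((n + 1 : ℕ) : N)) • v) h1
  rw [smul_smul (1 / ((n + 1 : ℕ) : N)) ((n + 1 : ℕ) : N), one_div_mul_cancel (hcast n), one_smul,
    smul_comm, smul_smul (1 / ((m + 1 : ℕ) : N)) ((m + 1 : ℕ) : N),
    one_div_mul_cancel (hcast m), one_smul] at h2
  exact h2

end TraceOfLogarithm

/-! ### Traces on group rings -/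

section Traces

variable {R : Type*} [CommRing R] {G : Type*} [Group G]

lemma phi_single (g : G) (r : R) :
    phi R G (MonoidAlgebra.single g r) = Finsupp.single (ConjClasses.mk g) r := by
  simp [phi, MonoidAlgebra.coeffLinearEquiv]

lemma psi_single (p : ℕ) (F : R →+* R) (g : G) (r : R) :
    psi p F (MonoidAlgebra.single g r) = MonoidAlgebra.single (g ^ p) (F r) := by
  simp [psi]

/-- An additive map on `R[G]` is a trace as soon as it does not distinguish `g h` from `h g`. -/
lemma trace_of_single {V : Type*} [AddCommGroup V] (T : R[G] →+ V)
    (h : ∀ (g g' : G) (r : R),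
      T (MonoidAlgebra.single (g * g') r) = T (MonoidAlgebra.single (g' * g) r))
    (a b : R[G]) : T (a * b) = T (b * a) := by
  have key : (AddMonoidHom.mul (R := R[G])).compr₂ T =
      (AddMonoidHom.mul (R := R[G])).flip.compr₂ T := by
    ext g r g' r'
    simp [MonoidAlgebra.single_mul_single, h g g', mul_comm r r']
  exact DFunLike.congr_fun (DFunLike.congr_fun key a) b

lemma conjClasses_mk_mul_comm (g h : G) : ConjClasses.mk (g * h) = ConjClasses.mk (h * g) :=
  ConjClasses.mk_eq_mk_iff_isConj.2 (isConj_iff.2 ⟨h, by group⟩)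

lemma phi_mul_comm (a b : R[G]) : phi R G (a * b) = phi R G (b * a) :=
  trace_of_single (phi R G).toAddMonoidHom (fun g g' r => by
    simp [phi_single, conjClasses_mk_mul_comm g g']) a b

lemma phi_psi_mul_comm (p : ℕ) (F : R →+* R) (a b : R[G]) :
    phi R G (psi p F (a * b)) = phi R G (psi p F (b * a)) :=
  trace_of_single ((phi R G).toAddMonoidHom.comp (psi p F)) (fun g g' r => by
    simp only [AddMonoidHom.comp_apply, psi_single, LinearMap.toAddMonoidHom_coe, phi_single]
    congr 1
    have h : IsConj (g * g') (g' * g) :=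
      ConjClasses.mk_eq_mk_iff_isConj.1 (conjClasses_mk_mul_comm g g')
    exact ConjClasses.mk_eq_mk_iff_isConj.2 (h.pow p)) a b

end Traces

/-! ### Sums over orbits of a permutation of prime power order -/

section Orbits

/-- Let `σ` be a permutation of order dividing `p ^ n` and `f` a `σ`-invariant function. If the
value of `f` at a point fixed by `σ ^ (p ^ j)` is divisible by `p ^ (n - j)`, then `∑ f` is
divisible by `p ^ n`: an orbit with `p ^ j` elements contributes `p ^ j` times one such value. -/
lemma sum_mem_padicNhd_of_perm {X M : Type*} [Fintype X] [AddCommGroup M] {p : ℕ} (hp : p.Prime)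
    (n : ℕ) (σ : Equiv.Perm X) (hσ : σ ^ p ^ n = 1) (f : X → M) (hf : ∀ x, f (σ x) = f x)
    (h : ∀ j ≤ n, ∀ x, (σ ^ p ^ j) x = x → f x ∈ padicNhd p (⊤ : AddSubgroup M) (n - j)) :
    ∑ x, f x ∈ padicNhd p (⊤ : AddSubgroup M) n := by
  classical
  let s : Setoid X := Equiv.Perm.SameCycle.setoid σ
  rw [Finset.sum_partition s]
  refine sum_mem fun q hq => ?_
  obtain ⟨x, -, rfl⟩ := Finset.mem_image.1 hq
  have hinv : ∀ y, σ.SameCycle x y → f y = f x := by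
    rintro y ⟨i, rfl⟩
    have hz : ∀ y, f (σ⁻¹ y) = f y := fun y => by
      simpa using (hf (σ⁻¹ y)).symm
    have hn : ∀ (τ : Equiv.Perm X), (∀ y, f (τ y) = f y) → ∀ (m : ℕ) y, f ((τ ^ m) y) = f y := by
      intro τ hτ m
      induction m with
      | zero => simp
      | succ m ih => intro y; rw [pow_succ, Equiv.Perm.mul_apply, ih, hτ]
    cases i with
    | ofNat m => exact hn σ hf m x
    | negSucc m =>
      rw [zpow_negSucc, ← inv_pow]
      exact hn σ⁻¹ hz (m + 1) x
  have hfil : (Finset.univ.filter fun y => (⟦y⟧ : Quotient s) = ⟦x⟧) =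
      Finset.univ.filter fun y => y ∈ MulAction.orbit (Subgroup.zpowers σ) x := by
    ext y
    simp only [Finset.mem_filter, Finset.mem_univ, true_and]
    rw [Quotient.eq]
    constructor
    · intro hy
      obtain ⟨i, hi⟩ := Equiv.Perm.SameCycle.symm hy
      exact ⟨⟨σ ^ i, i, rfl⟩, hi⟩
    · rintro ⟨⟨_, i, rfl⟩, hi⟩
      exact Equiv.Perm.SameCycle.symm ⟨i, hi⟩
  rw [Finset.sum_congr rfl (g := fun _ => f x) (fun y hy =>
    hinv y (Equiv.Perm.SameCycle.symm (Quotient.exact (Finset.mem_filter.1 hy).2))),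
    Finset.sum_const, hfil]
  have hper : Function.IsPeriodicPt (σ • ·) (p ^ n) x := by
    rw [Function.IsPeriodicPt, Function.IsFixedPt, smul_iterate, hσ]
    exact one_smul _ x
  obtain ⟨j, hj, hmin⟩ := (Nat.dvd_prime_pow hp).1 hper.minimalPeriod_dvd
  have hcard : (Finset.univ.filter fun y => y ∈ MulAction.orbit (Subgroup.zpowers σ) x).card =
      p ^ j := by
    rw [← Fintype.card_subtype, ← Nat.card_eq_fintype_card, ← hmin,
      ← Nat.card_zmod (Function.minimalPeriod (σ • ·) x)]
    exact Nat.card_congr (MulAction.orbitZPowersEquiv σ x)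
  have hfix : (σ ^ p ^ j) x = x := by
    have := Function.isPeriodicPt_minimalPeriod (σ • ·) x
    rw [hmin, Function.IsPeriodicPt, Function.IsFixedPt, smul_iterate] at this
    exact this
  obtain ⟨b, -, hb⟩ := mem_padicNhd.1 (h j hj x hfix)
  refine mem_padicNhd.2 ⟨b, trivial, ?_⟩
  rw [hcard, ← hb, ← mul_nsmul', ← pow_add, Nat.add_sub_cancel' hj]

end Orbits

/-! ### Periodic words and their products -/

section CyclicWords

variable {A : Type*} [Monoid A] {n : ℕ}

/-- The product `w 0 * w 1 * ⋯ * w (k - 1)` of the first `k` letters of the `n`-periodic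
word `w`. -/
def cycProd (w : ZMod n → A) (k : ℕ) : A := ((List.range k).map fun i : ℕ => w (i : ZMod n)).prod

lemma cycProd_zero (w : ZMod n → A) : cycProd w 0 = 1 := by simp [cycProd]

lemma cycProd_add (w : ZMod n → A) (a b : ℕ) :
    cycProd w (a + b) = cycProd w a * cycProd (fun i : ZMod n => w (i + (a : ZMod n))) b := by
  rw [cycProd, List.range_add, List.map_append, List.prod_append, List.map_map]
  simp [cycProd, Function.comp_def, add_comm]

lemma cycProd_one (w : ZMod n → A) : cycProd w 1 = w 0 := by simp [cycProd, List.range_succ]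

lemma cycProd_mul (w : ZMod n → A) (d e : ℕ) (hw : ∀ i, w (i + d) = w i) :
    cycProd w (d * e) = cycProd w d ^ e := by
  induction e with
  | zero => simp [cycProd_zero]
  | succ e ih =>
    rw [mul_add_one, add_comm, cycProd_add, pow_succ']
    simp only [hw, ih]

/-- A trace does not change when a word of period `k` is rotated. -/
lemma trace_cycProd_shift {V : Type*} (T : A → V) (hT : ∀ a b, T (a * b) = T (b * a))
    (w : ZMod n → A) (k : ℕ) (hw : w (k : ZMod n) = w 0) :
    T (cycProd (fun i : ZMod n => w (i + 1)) k) = T (cycProd w k) := by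
  cases k with
  | zero => simp [cycProd_zero]
  | succ k =>
    rw [cycProd_add, cycProd_one, hT, add_comm k 1, cycProd_add w 1 k, cycProd_one]
    simp only [zero_add, Nat.cast_one]
    rw [← hw]
    push_cast
    rfl

lemma sum_pow_eq_sum_cycProd {B ι : Type*} [Ring B] [Fintype ι] (y : ι → B) [NeZero n] :
    (∑ g, y g) ^ n = ∑ w : ZMod n → ι, cycProd (fun i => y (w i)) n := by
  classical
  obtain ⟨m, rfl⟩ := Nat.exists_eq_succ_of_ne_zero (NeZero.ne n)
  have h := (MultilinearMap.mkPiAlgebraFin ℤ (m + 1) B).map_sum (fun (_ : Fin (m + 1)) g => y g)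
  rw [MultilinearMap.mkPiAlgebraFin_apply_const] at h
  rw [h]
  refine Finset.sum_congr rfl fun w _ => ?_
  rw [MultilinearMap.mkPiAlgebraFin_apply, cycProd, ← List.map_coe_finRange_eq_range, List.map_map,
    List.ofFn_eq_map]
  refine congrArg List.prod (List.map_congr_left fun i _ => ?_)
  simp only [Function.comp_apply]
  congr 2
  exact (Fin.cast_val_eq_self i).symm

end CyclicWords

/-! ### The necklace congruence for `φ` and `Ψ` -/

section NecklaceCongruence

variable {R : Type*} [CommRing R] {G : Type*} [Group G]

/-- Rotation of cyclic words. -/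
def shift (n : ℕ) (ι : Type*) : Equiv.Perm (ZMod n → ι) where
  toFun w i := w (i + 1)
  invFun w i := w (i - 1)
  left_inv w := by ext; simp
  right_inv w := by ext; simp

lemma shift_apply {n : ℕ} {ι : Type*} (w : ZMod n → ι) (i : ZMod n) :
    shift n ι w i = w (i + 1) := rfl

lemma shift_pow_apply {n : ℕ} {ι : Type*} (m : ℕ) (w : ZMod n → ι) (i : ZMod n) :
    (shift n ι ^ m) w i = w (i + m) := by
  induction m generalizing i with
  | zero => simp
  | succ m ih =>
    rw [pow_succ', Equiv.Perm.mul_apply, shift_apply, ih]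
    congr 1
    push_cast
    ring

/-- The words of length `p ^ (s + 1)` with period `p ^ s` are the words of length `p ^ s`. -/
lemma sum_periodic_words {V ι : Type*} [AddCommGroup V] [Fintype ι] {p s : ℕ} [NeZero p]
    [DecidablePred fun w : ZMod (p ^ (s + 1)) → ι => ∀ i, w (i + (p ^ s : ℕ)) = w i]
    (f : (ℕ → ι) → V) :
    ∑ v : ZMod (p ^ s) → ι, f (fun i => v i) =
      ∑ w : ZMod (p ^ (s + 1)) → ι,
        if ∀ i, w (i + (p ^ s : ℕ)) = w i then f (fun i => w i) else 0 := by
  have hdvd : p ^ s ∣ p ^ (s + 1) := pow_dvd_pow p s.le_succ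
  let c := ZMod.castHom hdvd (ZMod (p ^ s))
  rw [← Finset.sum_filter]
  refine Finset.sum_bij (fun v _ => fun i => v (c i)) ?_ ?_ ?_ ?_
  · intro v _
    simp only [Finset.mem_filter, Finset.mem_univ, true_and]
    intro i
    rw [map_add, map_natCast, ZMod.natCast_self, add_zero]
  · intro v _ v' _ h
    ext i
    obtain ⟨j, rfl⟩ := ZMod.ringHom_surjective c i
    exact congrFun h j
  · intro w hw
    have hw' := (Finset.mem_filter.1 hw).2
    have hmul : ∀ (k : ℕ) i, w (i + (p ^ s * k : ℕ)) = w i := by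
      intro k
      induction k with
      | zero => simp
      | succ k ih =>
        intro i
        rw [mul_add_one, Nat.cast_add, ← add_assoc, hw', ih]
    refine ⟨fun i => w (i.val : ℕ), Finset.mem_univ _, ?_⟩
    ext i
    have h1 : (c i).val = i.val % p ^ s := by
      rw [← ZMod.val_natCast, ← map_natCast c, ZMod.natCast_zmod_val]
    have h2 := hmul (i.val / p ^ s) ((i.val % p ^ s : ℕ) : ZMod (p ^ (s + 1)))
    rw [← Nat.cast_add, Nat.mod_add_div, ZMod.natCast_zmod_val] at h2
    simp only [h1]
    exact h2.symm
  · intro v _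
    simp [c]

/-- The congruence `φ(y ^ (p ^ (s + 1))) ≡ φ(Ψ(y ^ (p ^ s))) mod p ^ (s + 1)`. Both powers are
expanded into words in the terms of `y`; the words of length `p ^ s` are matched with the
periodic words of length `p ^ (s + 1)`, and everything is grouped along rotation orbits. -/
lemma phi_pow_sub_phi_psi_mem [Finite G] {p : ℕ} (hp : p.Prime) (F : R →+* R)
    (hF : ∀ r : R, F r - r ^ p ∈ Ideal.span {(p : R)}) (y : R[G]) (s : ℕ) :
    phi R G (y ^ p ^ (s + 1)) - phi R G (psi p F (y ^ p ^ s)) ∈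
      padicNhd p (⊤ : AddSubgroup (ConjClasses G →₀ R)) (s + 1) := by
  classical
  have := Fintype.ofFinite G
  have : NeZero p := ⟨hp.ne_zero⟩
  let t : G → R[G] := fun g => MonoidAlgebra.single g (y.coeff g)
  have hy : y = ∑ g, t g := by
    conv_lhs => rw [← MonoidAlgebra.sum_coeff_single y]
    exact Finsupp.sum_fintype _ _ (by simp)
  let P : (ZMod (p ^ (s + 1)) → G) → Prop := fun w => ∀ i, w (i + (p ^ s : ℕ)) = w i
  let f : (ZMod (p ^ (s + 1)) → G) → (ConjClasses G →₀ R) := fun w =>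
    phi R G (cycProd (fun i => t (w i)) (p ^ (s + 1))) -
      if P w then phi R G (psi p F (cycProd (fun i => t (w i)) (p ^ s))) else 0
  have hsum : phi R G (y ^ p ^ (s + 1)) - phi R G (psi p F (y ^ p ^ s)) = ∑ w, f w := by
    rw [Finset.sum_sub_distrib, hy, sum_pow_eq_sum_cycProd, sum_pow_eq_sum_cycProd, map_sum,
      map_sum, map_sum]
    congr 1
    exact sum_periodic_words fun u : ℕ → G =>
      phi R G (psi p F ((List.range (p ^ s)).map fun i => t (u i)).prod)
  rw [hsum]
  refine sum_mem_padicNhd_of_perm hp (s + 1) (shift _ G) ?_ f ?_ ?_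
  · ext w i
    rw [shift_pow_apply]
    simp
  · intro w
    have hP : P (shift _ G w) ↔ P w := by
      constructor
      · intro h i
        have := h (i - 1)
        simpa [shift_apply, add_right_comm, sub_add_eq_add_sub] using this
      · intro h i
        simp only [shift_apply]
        rw [← h (i + 1), add_right_comm]
    simp only [f, hP, shift_apply]
    congr 1
    · exact trace_cycProd_shift (fun a => phi R G a) phi_mul_comm (fun i => t (w i)) _ (by simp)
    · split_ifs with h
      · refine trace_cycProd_shift (fun a => phi R G (psi p F a)) (phi_psi_mul_comm p F)
          (fun i => t (w i)) _ ?_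
        rw [← h 0, zero_add]
      · rfl
  · intro j hj w hw
    have hper : ∀ i, w (i + (p ^ j : ℕ)) = w i := fun i => by
      rw [← shift_pow_apply (p ^ j) w i, hw]
    rcases hj.eq_or_lt with rfl | hj
    · simp [padicNhd_zero]
    obtain ⟨k, rfl⟩ := Nat.exists_eq_add_of_le (Nat.lt_succ_iff.1 hj)
    have hmul : ∀ (k : ℕ) i, w (i + (p ^ j * k : ℕ)) = w i := by
      intro k
      induction k with
      | zero => simp
      | succ k ih =>
        intro i
        rw [mul_add_one, Nat.cast_add, ← add_assoc, hper, ih]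
    have hPw : P w := fun i => by
      have := hmul (p ^ k) i
      rwa [← pow_add] at this
    -- A word fixed by rotation by `p ^ j` is a power of its first `p ^ j` letters, whose product
    -- is a single term `r g`.
    obtain ⟨g, r, hgr⟩ : ∃ g r, cycProd (fun i => t (w i)) (p ^ j) = MonoidAlgebra.single g r := by
      generalize p ^ j = m
      induction m with
      | zero => exact ⟨1, 1, cycProd_zero _⟩
      | succ m ih =>
        obtain ⟨g, r, h⟩ := ih
        rw [cycProd_add, h, cycProd_one, MonoidAlgebra.single_mul_single]
        exact ⟨_, _, rfl⟩
    have e1 : cycProd (fun i => t (w i)) (p ^ (j + k + 1)) =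
        MonoidAlgebra.single (g ^ p ^ (k + 1)) (r ^ p ^ (k + 1)) := by
      rw [← MonoidAlgebra.single_pow, ← hgr, ← cycProd_mul _ _ _ (fun i => by rw [hper])]
      exact congrArg _ (by rw [add_assoc, pow_add])
    have e2 : cycProd (fun i => t (w i)) (p ^ (j + k)) =
        MonoidAlgebra.single (g ^ p ^ k) (r ^ p ^ k) := by
      rw [← MonoidAlgebra.single_pow, ← hgr, ← cycProd_mul _ _ _ (fun i => by rw [hper])]
      exact congrArg _ (by rw [pow_add])
    have hdvd : (p : R) ∣ r ^ p - F r := by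
      rw [← Ideal.mem_span_singleton, ← neg_sub]
      exact neg_mem (hF r)
    obtain ⟨b, hb⟩ := dvd_sub_pow_of_dvd_sub hdvd k
    have e3 : f w = Finsupp.single (ConjClasses.mk (g ^ p ^ (k + 1)))
        (r ^ p ^ (k + 1) - F r ^ p ^ k) := by
      simp only [f, if_pos hPw]
      rw [e1, e2, psi_single, phi_single, phi_single, ← pow_mul, ← pow_succ, map_pow,
        Finsupp.single_sub]
    rw [e3, pow_succ', pow_mul r, hb, show j + k + 1 - j = k + 1 by omega]
    refine mem_padicNhd.2 ⟨Finsupp.single (ConjClasses.mk (g ^ (p * p ^ k))) b, trivial, ?_⟩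
    rw [Finsupp.smul_single, nsmul_eq_mul, Nat.cast_pow]

end NecklaceCongruence

/-! ### Ideals generated by powers of `p` -/

section PrimePowerIdeals

variable {A : Type*} [Ring A] {p : ℕ}

lemma mem_span_natCast_pow {k : ℕ} {x : A} :
    x ∈ Ideal.span {(p : A) ^ k} ↔ ∃ r, x = (p : A) ^ k * r := by
  rw [Ideal.mem_span_singleton']
  have h : ∀ r : A, r * (p : A) ^ k = (p : A) ^ k * r := fun r => by
    rw [← Nat.cast_pow, (Nat.cast_commute _ r).eq]
  simp only [h, eq_comm]

instance isTwoSided_span_natCast_pow (k : ℕ) : (Ideal.span {(p : A) ^ k}).IsTwoSided where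
  mul_mem_of_left b h := by
    obtain ⟨r, rfl⟩ := mem_span_natCast_pow.1 h
    exact mem_span_natCast_pow.2 ⟨r * b, mul_assoc _ _ _⟩

instance isTwoSided_sup (I J : Ideal A) [I.IsTwoSided] [J.IsTwoSided] : (I ⊔ J).IsTwoSided where
  mul_mem_of_left b h := by
    obtain ⟨x, hx, y, hy, rfl⟩ := Submodule.mem_sup.1 h
    rw [add_mul]
    exact Submodule.add_mem_sup (I.mul_mem_right b hx) (J.mul_mem_right b hy)

lemma mem_padicNhd_ring {k : ℕ} {x : A} :
    x ∈ padicNhd p (⊤ : AddSubgroup A) k ↔ x ∈ Ideal.span {(p : A) ^ k} := by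
  rw [mem_span_natCast_pow, mem_padicNhd]
  constructor
  · rintro ⟨r, -, rfl⟩
    exact ⟨r, by simp⟩
  · rintro ⟨r, rfl⟩
    exact ⟨r, trivial, by simp⟩

/-- If `I ^ M ⊆ (p)`, then the powers of `I` tend to `0` for the `p`-adic topology. -/
lemma pow_le_span_natCast_pow {I : Ideal A} [I.IsTwoSided] {M : ℕ}
    (hI : I ^ M ≤ Ideal.span {(p : A)}) {n k : ℕ} (h : M * k ≤ n) :
    I ^ n ≤ Ideal.span {(p : A) ^ k} := by
  have h1 : ∀ k, I ^ (M * k) ≤ Ideal.span {(p : A) ^ k} := by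
    intro k
    induction k with
    | zero => simp
    | succ k ih =>
      rw [mul_add_one, Ideal.IsTwoSided.pow_add, Ideal.mul_le]
      intro a ha b hb
      obtain ⟨r, rfl⟩ := mem_span_natCast_pow.1 (ih ha)
      have hb' := hI hb
      rw [← pow_one (p : A)] at hb'
      obtain ⟨r', rfl⟩ := mem_span_natCast_pow.1 hb'
      refine mem_span_natCast_pow.2 ⟨r * r', ?_⟩
      rw [pow_one, pow_succ, mul_assoc, mul_assoc, ← mul_assoc r, ← (Nat.cast_commute p r).eq,
        mul_assoc]
  exact (Ideal.pow_le_pow_right h).trans (h1 k)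

end PrimePowerIdeals

/-! ### Power series on topologically nilpotent ideals -/

section FixedPoint

variable {A : Type*} [Ring A] {p : ℕ}

lemma pow_sub_pow_mem {E : Ideal A} [E.IsTwoSided] {x y : A} (h : x - y ∈ E) (n : ℕ) :
    x ^ n - y ^ n ∈ E := by
  induction n with
  | zero => simp
  | succ n ih =>
    have : x ^ (n + 1) - y ^ (n + 1) = x ^ n * (x - y) + (x ^ n - y ^ n) * y := by
      rw [pow_succ, pow_succ]; noncomm_ring
    rw [this]
    exact add_mem (E.mul_mem_left _ h) (E.mul_mem_right _ ih)

/-- Let `I` be a two-sided ideal that is closed and topologically nilpotent for the `p`-adic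
topology. A power series `x + c₂ x² + c₃ x³ + ⋯` maps `I` onto `I`: the equation `f x = y` is
solved by iterating `x ↦ x + (y - f x)`, which is contracting for the filtration by the
powers of `I`, up to any given power of `p`. -/
lemma exists_powerSeries_eq (hsep : PadicSeparated p (⊤ : AddSubgroup A))
    (hcomp : PadicComplete A p) (I : Ideal A) [I.IsTwoSided] {M : ℕ}
    (hI : I ^ M ≤ Ideal.span {(p : A)})
    (hclosed : ∀ x, (∀ k, ∃ a ∈ I, x - a ∈ Ideal.span {(p : A) ^ k}) → x ∈ I)
    (c : ℕ → A) (hc : c 0 = 1) {y : A} (hy : y ∈ I) :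
    ∃ x ∈ I, SumsTo p ⊤ (fun n => c n * x ^ (n + 1)) y := by
  have hex : ∀ x ∈ I, ∃ s, SumsTo p ⊤ (fun n => c n * x ^ (n + 1)) s := by
    intro x hx
    refine hcomp _ fun k => ?_
    filter_upwards [eventually_ge_atTop (M * k)] with n hn
    rw [mem_padicNhd_ring]
    exact Ideal.mul_mem_left _ _
      (pow_le_span_natCast_pow hI (hn.trans n.le_succ) (Ideal.pow_mem_pow hx _))
  choose! f hf using hex
  have hfI : ∀ x ∈ I, f x ∈ I := by
    intro x hx
    refine hclosed _ fun k => ?_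
    obtain ⟨m, hm⟩ := (hf x hx k).exists
    refine ⟨∑ n ∈ Finset.range m, c n * x ^ (n + 1), sum_mem fun n _ =>
      I.mul_mem_left (c n) (I.pow_mem_of_mem hx (n + 1) n.succ_pos), ?_⟩
    rw [← neg_sub]
    exact neg_mem (mem_padicNhd_ring.1 hm)
  -- If the partial sums at `x` and `x'` agree modulo `E`, then so do the sums, up to `p ^ K`.
  have hdiff : ∀ (E : Ideal A) (K : ℕ), Ideal.span {(p : A) ^ K} ≤ E → ∀ x ∈ I, ∀ x' ∈ I,
      (∀ n, c (n + 1) * x ^ (n + 2) - c (n + 1) * x' ^ (n + 2) ∈ E) →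
      (f x - x) - (f x' - x') ∈ E := by
    intro E K hKE x hx x' hx' h
    obtain ⟨m, h1, h2, hm⟩ :=
      ((hf x hx K).and ((hf x' hx' K).and (eventually_ge_atTop 1))).exists
    obtain ⟨m, rfl⟩ := Nat.exists_eq_add_of_le' hm
    rw [mem_padicNhd_ring] at h1 h2
    have h3 : (∑ n ∈ Finset.range (m + 1), c n * x ^ (n + 1)) -
        (∑ n ∈ Finset.range (m + 1), c n * x' ^ (n + 1)) - (x - x') ∈ E := by
      rw [Finset.sum_range_succ', Finset.sum_range_succ', hc]
      simp only [zero_add, pow_one, one_mul]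
      rw [add_sub_add_comm, add_sub_cancel_right, ← Finset.sum_sub_distrib]
      exact sum_mem fun n _ => h n
    have h4 := add_mem (sub_mem (hKE h2) (hKE h1)) h3
    convert h4 using 1
    abel
  have hE : ∀ j K x, x ∈ I → ∀ x' ∈ I, x - x' ∈ I ^ j ⊔ Ideal.span {(p : A) ^ K} →
      (f x - x) - (f x' - x') ∈ I ^ (j + 1) ⊔ Ideal.span {(p : A) ^ K} := by
    intro j K x hx x' hx' h
    refine hdiff _ K le_sup_right x hx x' hx' fun n => ?_
    rw [← mul_sub]
    refine Ideal.mul_mem_left _ _ ?_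
    have e : x ^ (n + 2) - x' ^ (n + 2) =
        x ^ (n + 1) * (x - x') + (x ^ (n + 1) - x' ^ (n + 1)) * x' := by
      rw [pow_succ x (n + 1), pow_succ x' (n + 1)]; noncomm_ring
    have hl : ∀ a ∈ I, ∀ b ∈ I ^ j ⊔ Ideal.span {(p : A) ^ K},
        a * b ∈ I ^ (j + 1) ⊔ Ideal.span {(p : A) ^ K} := by
      intro a ha b hb
      obtain ⟨u, hu, v, hv, rfl⟩ := Submodule.mem_sup.1 hb
      rw [mul_add, Ideal.IsTwoSided.pow_succ]
      exact Submodule.add_mem_sup (Ideal.mul_mem_mul ha hu) (Ideal.mul_mem_left _ _ hv)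
    have hr : ∀ a ∈ I, ∀ b ∈ I ^ j ⊔ Ideal.span {(p : A) ^ K},
        b * a ∈ I ^ (j + 1) ⊔ Ideal.span {(p : A) ^ K} := by
      intro a ha b hb
      obtain ⟨u, hu, v, hv, rfl⟩ := Submodule.mem_sup.1 hb
      rw [add_mul, Ideal.IsTwoSided.pow_add, Submodule.pow_one]
      exact Submodule.add_mem_sup (Ideal.mul_mem_mul hu ha) (Ideal.mul_mem_right _ _ hv)
    rw [e]
    exact add_mem (hl _ (I.pow_mem_of_mem hx _ n.succ_pos) _ h)
      (hr _ hx' _ (pow_sub_pow_mem h _))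
  -- The increments of the iteration `u` are the defects `y - f (u j)`.
  let u : ℕ → A := fun j => Nat.rec 0 (fun _ x => x + (y - f x)) j
  have hu0 : u 0 = 0 := rfl
  have hus : ∀ j, u (j + 1) = u j + (y - f (u j)) := fun j => rfl
  have huI : ∀ j, u j ∈ I := by
    intro j
    induction j with
    | zero => exact I.zero_mem
    | succ j ih => exact add_mem ih (sub_mem hy (hfI _ ih))
  have hmain : ∀ K j, y - f (u j) ∈ I ^ (j + 1) ⊔ Ideal.span {(p : A) ^ K} := by
    intro K j
    induction j with
    | zero =>
      rw [zero_add, Submodule.pow_one]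
      exact Submodule.mem_sup_left (sub_mem hy (hfI _ (huI 0)))
    | succ j ih =>
      have h1 : u j - u (j + 1) ∈ I ^ (j + 1) ⊔ Ideal.span {(p : A) ^ K} := by
        rw [hus, sub_add_cancel_left]
        exact neg_mem ih
      have h2 := hE (j + 1) K _ (huI j) _ (huI (j + 1)) h1
      convert h2 using 1
      rw [hus]
      abel
  have hsmall : ∀ K, ∀ᶠ j in atTop, y - f (u j) ∈ Ideal.span {(p : A) ^ K} := by
    intro K
    filter_upwards [eventually_ge_atTop (M * K)] with j hj
    exact sup_le (pow_le_span_natCast_pow hI (hj.trans j.le_succ)) le_rfl (hmain K j)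
  obtain ⟨x, hx⟩ := hcomp (fun j => y - f (u j)) fun K =>
    (hsmall K).mono fun j hj => mem_padicNhd_ring.2 hj
  have hpart : ∀ m, ∑ j ∈ Finset.range m, (y - f (u j)) = u m := by
    intro m
    induction m with
    | zero => rfl
    | succ m ih => rw [Finset.sum_range_succ, ih, hus]
  have hux : ∀ K, ∀ᶠ m in atTop, u m - x ∈ Ideal.span {(p : A) ^ K} := fun K =>
    (hx K).mono fun m hm => by rwa [hpart, mem_padicNhd_ring] at hm
  have hxI : x ∈ I := by
    refine hclosed _ fun K => ?_
    obtain ⟨m, hm⟩ := (hux K).exists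
    exact ⟨u m, huI m, by rw [← neg_sub]; exact neg_mem hm⟩
  refine ⟨x, hxI, ?_⟩
  have : y - f x = 0 := by
    refine hsep _ fun K => mem_padicNhd_ring.2 ?_
    obtain ⟨m, h1, h2⟩ := ((hux K).and (hsmall K)).exists
    have h3 := hdiff _ K le_rfl _ (huI m) x hxI fun n => by
      rw [← mul_sub]
      exact Ideal.mul_mem_left _ _ (pow_sub_pow_mem h1 _)
    have h4 := add_mem (add_mem h2 h3) h1
    convert h4 using 1
    abel
  rw [sub_eq_zero.1 this]
  exact hf x hxI

end FixedPoint

/-! ### Powers of `1 - z` for `z ^ p = 1` -/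

section OneSubRootOfUnity

lemma isUnit_natCast_of_coprime {p : ℕ} {R : Type*} [CommRing R]
    [IsAdicComplete (Ideal.span {(p : R)}) R] {n : ℕ} (h : n.Coprime p) : IsUnit (n : R) := by
  have h1 := Nat.isCoprime_iff_coprime.2 h
  obtain ⟨a, b, hab⟩ := h1
  have h2 : (a : R) * (n : R) = (p : R) * (-(b : R)) + 1 := by
    have := congrArg (Int.cast (R := R)) hab
    push_cast at this
    linear_combination this
  have h3 : (p : R) ∈ (⊥ : Ideal R).jacobson :=
    IsAdicComplete.le_jacobson_bot (Ideal.span {(p : R)}) (Ideal.mem_span_singleton_self _)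
  have h4 := Ideal.mem_jacobson_bot.1 h3 (-(b : R))
  rw [← h2] at h4
  exact isUnit_of_mul_isUnit_right h4

/-- If `z ^ p = 1`, then `(1 - z) ^ p` is divisible by `p (1 - z)`. -/
lemma one_sub_pow_prime {B : Type*} [CommRing B] {p : ℕ} (hp : p.Prime) {z : B} (hz : z ^ p = 1) :
    ∃ e, (1 - z) ^ p = p * ((1 - z) * e) := by
  obtain ⟨r, hr⟩ := exists_add_pow_prime_eq hp (1 - z) z
  refine ⟨-(z * r), ?_⟩
  rw [sub_add_cancel, one_pow, hz] at hr
  linear_combination -hr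

/-- If `z ^ p = 1`, then `(1 - z) ^ n` is divisible by `n (1 - z)`: this is what makes
`log (1 - (1 - z) x)` a series with coefficients divisible by `1 - z`. -/
lemma one_sub_pow_eq {B : Type*} [CommRing B] {p : ℕ} (hp : p.Prime)
    (hunit : ∀ n : ℕ, n.Coprime p → IsUnit (n : B)) {z : B} (hz : z ^ p = 1) {n : ℕ} (hn : n ≠ 0) :
    ∃ c, (1 - z) ^ n = n * ((1 - z) * c) := by
  have hpow : ∀ s : ℕ, ∃ c, (1 - z) ^ p ^ s = (p : B) ^ s * ((1 - z) * c) := by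
    obtain ⟨e, he⟩ := one_sub_pow_prime hp hz
    intro s
    induction s with
    | zero => exact ⟨1, by simp⟩
    | succ s ih =>
      obtain ⟨c, hc⟩ := ih
      obtain ⟨d, hd⟩ : ∃ d, s * p = s + d :=
        Nat.exists_eq_add_of_le (Nat.le_mul_of_pos_right s hp.pos)
      refine ⟨(p : B) ^ d * e * c ^ p, ?_⟩
      rw [pow_succ p s, pow_mul, hc, mul_pow, mul_pow, he, ← pow_mul, hd]
      ring
  obtain ⟨s, m, hm, rfl⟩ := Nat.exists_eq_pow_mul_and_not_dvd hn p hp.ne_one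
  obtain ⟨c, hc⟩ := hpow s
  obtain ⟨v, hv⟩ := (hunit m ((hp.coprime_iff_not_dvd.2 hm).symm)).exists_right_inv
  obtain ⟨m, rfl⟩ := Nat.exists_eq_succ_of_ne_zero (n := m) (by rintro rfl; simp at hm)
  refine ⟨v * c * ((1 - z) ^ p ^ s) ^ m, ?_⟩
  rw [pow_mul, pow_succ]
  nth_rw 2 [hc]
  push_cast at hv ⊢
  linear_combination -(p : B) ^ s * (1 - z) * c * ((1 - z) ^ p ^ s) ^ m * hv

/-- The version of `one_sub_pow_eq` for a central element of a noncommutative algebra. -/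
lemma one_sub_pow_eq_of_mem_center {R A : Type*} [CommRing R] [Ring A] [Algebra R A] {p : ℕ}
    (hp : p.Prime) (hunit : ∀ n : ℕ, n.Coprime p → IsUnit (n : R)) {z : A}
    (hzc : z ∈ Subalgebra.center R A) (hz : z ^ p = 1) {n : ℕ} (hn : n ≠ 0) :
    ∃ c ∈ Subalgebra.center R A, (1 - z) ^ n = n * ((1 - z) * c) := by
  obtain ⟨c, hc⟩ := one_sub_pow_eq (B := Subalgebra.center R A) hp (fun n hn => by
    simpa using (hunit n hn).map (algebraMap R (Subalgebra.center R A))) (z := ⟨z, hzc⟩)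
    (Subtype.ext hz) hn
  have h := congrArg (Subalgebra.center R A).val hc
  simp only [map_mul, map_pow, map_natCast] at h
  exact ⟨c, c.2, h⟩

end OneSubRootOfUnity

/-! ### Kernels of maps between group rings -/

section Kernels

variable {R : Type*} [CommRing R]

/-- The kernel of the map of free modules induced by `f : X → Y` is generated by the differences
`r a - r b` with `f a = f b`. -/
lemma mem_of_mapDomain_eq_zero {X Y : Type*} (f : X → Y) (W : AddSubgroup (X →₀ R))
    (hW : ∀ a b r, f a = f b → Finsupp.single a r - Finsupp.single b r ∈ W)
    {s : X →₀ R} (hs : Finsupp.mapDomain f s = 0) : s ∈ W := by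
  rcases isEmpty_or_nonempty X with hX | hX
  · rw [Subsingleton.elim s 0]
    exact zero_mem W
  have key : ∀ s : X →₀ R,
      s - Finsupp.mapDomain (Function.invFun f) (Finsupp.mapDomain f s) ∈ W := by
    intro s
    induction s using Finsupp.induction_linear with
    | zero => simp
    | add s t hs ht =>
      rw [Finsupp.mapDomain_add, Finsupp.mapDomain_add, add_sub_add_comm]
      exact add_mem hs ht
    | single a r =>
      rw [Finsupp.mapDomain_single, Finsupp.mapDomain_single]
      exact hW _ _ _ (Function.invFun_eq ⟨a, rfl⟩).symm
  simpa [hs] using key s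

variable {G : Type*} [Group G]

lemma of_mem_center {z : G} (hz : z ∈ Subgroup.center G) :
    (MonoidAlgebra.of R G z : R[G]) ∈ Subalgebra.center R R[G] := by
  rw [Subalgebra.mem_center_iff]
  intro b
  induction b using MonoidAlgebra.induction_on with
  | of g =>
    rw [← map_mul, ← map_mul, Subgroup.mem_center_iff.1 hz g]
  | add a b ha hb => rw [add_mul, mul_add, ha, hb]
  | smul r a ha => rw [smul_mul_assoc, mul_smul_comm, ha]

/-- Group elements in the same coset of the subgroup generated by a central `z` differ by a multiple
of `1 - z`. -/
lemma single_sub_single_zpowers [Finite G] {z : G} (hz : z ∈ Subgroup.center G) {h : G}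
    (hh : h ∈ Subgroup.zpowers z) (b : G) (r : R) :
    ∃ w : R[G], MonoidAlgebra.single b r - MonoidAlgebra.single (b * h) r =
      (1 - MonoidAlgebra.of R G z) * w := by
  obtain ⟨i, rfl⟩ := (isOfFinOrder_of_finite z).mem_powers_iff_mem_zpowers.2 hh
  refine ⟨(∑ j ∈ Finset.range i, MonoidAlgebra.of R G z ^ j) * MonoidAlgebra.single b r, ?_⟩
  have hc := Subgroup.mem_center_iff.1 (pow_mem hz i) b
  rw [← mul_assoc, one_sub_mul_geom, ← map_pow, sub_mul, one_mul, MonoidAlgebra.of_apply,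
    MonoidAlgebra.single_mul_single, one_mul, ← hc]

/-- The kernel of `R[G] → R[G ⧸ ⟨z⟩]`, for a central `z`, is generated by `1 - z`. -/
lemma exists_mul_of_mapDomain_quotient_eq_zero [Finite G] {z : G} (hz : z ∈ Subgroup.center G)
    {H : Type*} [Group H] (f : G →* H) (hf : f.ker = Subgroup.zpowers z) {x : R[G]}
    (hx : MonoidAlgebra.mapDomainRingHom R f x = 0) :
    ∃ w, x = (1 - MonoidAlgebra.of R G z) * w := by
  let W : AddSubgroup (G →₀ R) :=
    (AddMonoidHom.mulLeft (1 - MonoidAlgebra.of R G z)).range.map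
      (MonoidAlgebra.coeffAddEquiv (R := R) (M := G)).toAddMonoidHom
  have h : x.coeff ∈ W := by
    refine mem_of_mapDomain_eq_zero f W ?_ (congrArg MonoidAlgebra.coeff hx)
    intro b a r hab
    have hm : b⁻¹ * a ∈ Subgroup.zpowers z := by
      rw [← hf, MonoidHom.mem_ker, map_mul, map_inv, hab, inv_mul_cancel]
    obtain ⟨w, hw⟩ := single_sub_single_zpowers hz hm b r
    rw [mul_inv_cancel_left] at hw
    exact ⟨_, ⟨w, rfl⟩, congrArg MonoidAlgebra.coeff hw.symm⟩
  obtain ⟨_, ⟨w, rfl⟩, hw⟩ := h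
  exact ⟨w, (MonoidAlgebra.coeff_injective hw).symm⟩

lemma mapDomainRingHom_single {H : Type*} [Group H] (f : G →* H) (g : G) (r : R) :
    MonoidAlgebra.mapDomainRingHom R f (MonoidAlgebra.single g r) =
      MonoidAlgebra.single (f g) r :=
  MonoidAlgebra.mapDomain_single

lemma mapDomainRingHom_surjective {H : Type*} [Group H] {f : G →* H}
    (hf : Function.Surjective f) :
    Function.Surjective (MonoidAlgebra.mapDomainRingHom R f) := by
  intro y
  induction y using MonoidAlgebra.induction_linear with
  | zero => exact ⟨0, map_zero _⟩
  | add a b ha hb =>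
    obtain ⟨x, rfl⟩ := ha
    obtain ⟨y, rfl⟩ := hb
    exact ⟨x + y, map_add _ _ _⟩
  | single g r =>
    obtain ⟨g, rfl⟩ := hf g
    exact ⟨MonoidAlgebra.single g r, mapDomainRingHom_single f g r⟩

lemma phi_surjective : Function.Surjective (phi R G) := by
  intro y
  induction y using Finsupp.induction_linear with
  | zero => exact ⟨0, map_zero _⟩
  | add a b ha hb =>
    obtain ⟨x, rfl⟩ := ha
    obtain ⟨y, rfl⟩ := hb
    exact ⟨x + y, map_add _ _ _⟩
  | single g r =>
    obtain ⟨g, rfl⟩ := ConjClasses.mk_surjective g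
    exact ⟨MonoidAlgebra.single g r, phi_single g r⟩

/-- The kernel of `R[C_G] → R[C_{G ⧸ ⟨z⟩}]`, for a central `z`, is the image under `φ` of the ideal
generated by `1 - z`. -/
lemma exists_phi_mul_of_mapDomain_eq_zero [Finite G] {z : G} (hz : z ∈ Subgroup.center G)
    {H : Type*} [Group H] (f : G →* H) (hsurj : Function.Surjective f)
    (hf : f.ker = Subgroup.zpowers z) {t : ConjClasses G →₀ R}
    (ht : Finsupp.mapDomain (ConjClasses.map f) t = 0) :
    ∃ w, t = phi R G ((1 - MonoidAlgebra.of R G z) * w) := by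
  let W : AddSubgroup (ConjClasses G →₀ R) :=
    ((phi R G).toAddMonoidHom.comp (AddMonoidHom.mulLeft (1 - MonoidAlgebra.of R G z))).range
  have h : t ∈ W := by
    refine mem_of_mapDomain_eq_zero (ConjClasses.map f) W ?_ ht
    intro a b r hab
    obtain ⟨a, rfl⟩ := ConjClasses.mk_surjective a
    obtain ⟨b, rfl⟩ := ConjClasses.mk_surjective b
    obtain ⟨c, hc⟩ := isConj_iff.1 (ConjClasses.mk_eq_mk_iff_isConj.1 hab)
    obtain ⟨c, rfl⟩ := hsurj c
    have hm : (c * a * c⁻¹)⁻¹ * b ∈ Subgroup.zpowers z := by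
      rw [← hf, MonoidHom.mem_ker, map_mul, map_inv, map_mul, map_mul, map_inv, hc,
        inv_mul_cancel]
    obtain ⟨w, hw⟩ := single_sub_single_zpowers hz hm (c * a * c⁻¹) r
    refine ⟨w, ?_⟩
    rw [mul_inv_cancel_left] at hw
    have hconj : ConjClasses.mk (c * a * c⁻¹) = ConjClasses.mk a :=
      (ConjClasses.mk_eq_mk_iff_isConj.2 (isConj_iff.2 ⟨c, rfl⟩)).symm
    have h2 := congrArg (phi R G) hw
    rw [map_sub, phi_single, phi_single, hconj] at h2
    exact h2.symm
  obtain ⟨w, hw⟩ := h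
  exact ⟨w, hw.symm⟩

end Kernels

/-! ### Central elements of finite `p`-groups -/

section Groups

variable {p : ℕ} {G : Type*} [Group G]

lemma exists_pow_ne_one_pow_prime_eq_one [Fact p.Prime] (hG : IsPGroup p G) {g : G} (hg : g ≠ 1) :
    ∃ k : ℕ, g ^ k ≠ 1 ∧ (g ^ k) ^ p = 1 := by
  obtain ⟨n, hn⟩ := hG g
  have hex : ∃ n, g ^ p ^ n = 1 := ⟨n, hn⟩
  classical
  have hpos : Nat.find hex ≠ 0 := by
    intro h0
    have := Nat.find_spec hex
    rw [h0, pow_zero, pow_one] at this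
    exact hg this
  obtain ⟨m, hm⟩ := Nat.exists_eq_succ_of_ne_zero hpos
  refine ⟨p ^ m, Nat.find_min hex (by omega), ?_⟩
  rw [← pow_mul, ← pow_succ, ← Nat.succ_eq_add_one, ← hm]
  exact Nat.find_spec hex

lemma exists_mem_center_pow_eq_one [Fact p.Prime] [Finite G] [Nontrivial G] (hG : IsPGroup p G) :
    ∃ z ∈ Subgroup.center G, z ≠ 1 ∧ z ^ p = 1 := by
  have := hG.center_nontrivial
  obtain ⟨⟨z, hz⟩, hz1⟩ := exists_ne (1 : Subgroup.center G)
  obtain ⟨k, h1, h2⟩ := exists_pow_ne_one_pow_prime_eq_one hG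
    (g := z) (fun h => hz1 (Subtype.ext h))
  exact ⟨z ^ k, pow_mem hz k, h1, h2⟩

open scoped commutatorElement in
/-- A nonabelian finite `p`-group has a central commutator of order `p`. -/
lemma exists_commutator_mem_center [Fact p.Prime] [Finite G] (hG : IsPGroup p G)
    (hab : ∃ g h : G, g * h ≠ h * g) :
    ∃ a b : G, ⁅a, b⁆ ∈ Subgroup.center G ∧ ⁅a, b⁆ ≠ 1 ∧ ⁅a, b⁆ ^ p = 1 := by
  have hnt : Nontrivial (G ⧸ Subgroup.center G) := by
    rw [← not_subsingleton_iff_nontrivial]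
    intro h
    obtain ⟨g, k, hgk⟩ := hab
    exact hgk (Subgroup.mem_center_iff.1 ((QuotientGroup.eq_one_iff k).1 (Subsingleton.elim _ _)) g)
  have hQ : IsPGroup p (G ⧸ Subgroup.center G) := hG.to_quotient _
  have := hQ.center_nontrivial
  obtain ⟨⟨q, hq⟩, hq1⟩ := exists_ne (1 : Subgroup.center (G ⧸ Subgroup.center G))
  obtain ⟨a, rfl⟩ := QuotientGroup.mk_surjective q
  -- `a` is noncentral, but central modulo the center.
  have ha : a ∉ Subgroup.center G := fun h => hq1 (Subtype.ext ((QuotientGroup.eq_one_iff a).2 h))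
  have hcomm : ∀ b, ⁅a, b⁆ ∈ Subgroup.center G := by
    intro b
    rw [← QuotientGroup.eq_one_iff]
    have h := Subgroup.mem_center_iff.1 hq (b : G ⧸ Subgroup.center G)
    rw [commutatorElement_def, QuotientGroup.mk_mul, QuotientGroup.mk_mul, QuotientGroup.mk_mul,
      ← h]
    simp
  have hpow : ∀ (b : G) (k : ℕ), ⁅a, b ^ k⁆ = ⁅a, b⁆ ^ k := by
    intro b k
    induction k with
    | zero => simp
    | succ k ih =>
      have h := Subgroup.mem_center_iff.1 (hcomm b) (b ^ k)
      rw [pow_succ, pow_succ, ← ih]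
      have e : ⁅a, b ^ k * b⁆ = ⁅a, b ^ k⁆ * (b ^ k * ⁅a, b⁆ * (b ^ k)⁻¹) := by
        simp only [commutatorElement_def]; group
      rw [e, h, mul_inv_cancel_right]
  obtain ⟨b, hb⟩ : ∃ b : G, ⁅a, b⁆ ≠ 1 := by
    by_contra! h
    exact ha (Subgroup.mem_center_iff.2 fun g =>
      (commutatorElement_eq_one_iff_mul_comm.1 (h g)).symm)
  obtain ⟨k, h1, h2⟩ := exists_pow_ne_one_pow_prime_eq_one hG hb
  rw [← hpow] at h1 h2
  exact ⟨a, b ^ k, hcomm _, h1, h2⟩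

lemma card_quotient_zpowers_lt [Finite G] {z : G} (hz1 : z ≠ 1) :
    Nat.card (G ⧸ Subgroup.zpowers z) < Nat.card G := by
  rw [Subgroup.card_eq_card_quotient_mul_card_subgroup (Subgroup.zpowers z)]
  have : Nontrivial (Subgroup.zpowers z) := by
    rwa [Subgroup.nontrivial_iff_ne_bot, Ne, Subgroup.zpowers_eq_bot]
  exact lt_mul_of_one_lt_right Nat.card_pos Finite.one_lt_card

lemma normal_zpowers_of_mem_center {z : G} (hz : z ∈ Subgroup.center G) :
    (Subgroup.zpowers z).Normal :=
  ⟨fun n hn g => by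
    have hc : n ∈ Subgroup.center G := (Subgroup.zpowers_le.2 hz) hn
    rw [Subgroup.mem_center_iff.1 hc g, mul_inv_cancel_right]
    exact hn⟩

end Groups

/-! ### The augmentation ideal -/

section AugmentationIdeal

variable {R : Type*} [CommRing R] {G : Type*} [Group G]

variable (R G) in
/-- The augmentation `R[G] → R`. -/
def aug : R[G] →+* R := (MonoidAlgebra.lift R R G (1 : G →* R)).toRingHom

lemma aug_single (g : G) (r : R) : aug R G (MonoidAlgebra.single g r) = r := by
  simp [aug, MonoidAlgebra.lift_single]

lemma mem_augIdeal {x : R[G]} : x ∈ augIdeal R G ↔ aug R G x = 0 := Iff.rfl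

instance : (augIdeal R G).IsTwoSided := inferInstanceAs (RingHom.ker (aug R G)).IsTwoSided

lemma aug_mapDomainRingHom {H : Type*} [Group H] (f : G →* H) (x : R[G]) :
    aug R H (MonoidAlgebra.mapDomainRingHom R f x) = aug R G x := by
  induction x using MonoidAlgebra.induction_linear with
  | zero => simp
  | add a b ha hb => simp only [map_add, ha, hb]
  | single g r => rw [mapDomainRingHom_single, aug_single, aug_single]

lemma abKernel_le_augIdeal : abKernel R G ≤ augIdeal R G := by
  intro x hx
  rw [mem_augIdeal, ← aug_mapDomainRingHom Abelianization.of, show _ = _ from hx, map_zero]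

lemma augIdeal_closed {p : ℕ} [IsHausdorff (Ideal.span {(p : R)}) R] (x : R[G])
    (h : ∀ k, ∃ a ∈ augIdeal R G, x - a ∈ Ideal.span {(p : R[G]) ^ k}) : x ∈ augIdeal R G := by
  rw [mem_augIdeal]
  refine padicSeparated_self (p := p) _ fun k => ?_
  obtain ⟨a, ha, hxa⟩ := h k
  have h1 := map_mem_padicNhd (Λ' := ⊤) (aug R G).toAddMonoidHom (fun _ _ => trivial)
    (mem_padicNhd_ring.2 hxa)
  simpa [mem_augIdeal.1 ha] using h1

/-- The augmentation ideal of a finite `p`-group is nilpotent modulo `p`. -/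
lemma exists_augIdeal_pow_le (R : Type*) [CommRing R] {p : ℕ} (hp : p.Prime) :
    ∀ (n : ℕ) (G : Type*) [Group G] [Finite G], IsPGroup p G → Nat.card G = n →
      ∃ M : ℕ, augIdeal R G ^ M ≤ Ideal.span {(p : R[G])} := by
  have := Fact.mk hp
  intro n
  induction n using Nat.strong_induction_on with
  | _ n ih =>
    intro G _ _ hG hn
    rcases subsingleton_or_nontrivial G with hG1 | hG1
    · refine ⟨1, ?_⟩
      rw [Submodule.pow_one]
      intro x hx
      have hx1 : x = MonoidAlgebra.single 1 (x.coeff 1) := by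
        ext g
        rw [Subsingleton.elim g 1]
        simp
      rw [mem_augIdeal, hx1, aug_single] at hx
      rw [hx1, hx, MonoidAlgebra.single_zero]
      exact zero_mem _
    obtain ⟨z, hz, hz1, hzp⟩ := exists_mem_center_pow_eq_one hG
    have := normal_zpowers_of_mem_center hz
    obtain ⟨M, hM⟩ := ih _ (hn ▸ card_quotient_zpowers_lt hz1) (G ⧸ Subgroup.zpowers z)
      (hG.to_quotient _) rfl
    let q := MonoidAlgebra.mapDomainRingHom R (QuotientGroup.mk' (Subgroup.zpowers z))
    have hq : Function.Surjective q := mapDomainRingHom_surjective (QuotientGroup.mk'_surjective _)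
    set π : R[G] := 1 - MonoidAlgebra.of R G z with hπ
    have hπc : ∀ b, b * π = π * b := fun b =>
      Subalgebra.mem_center_iff.1 (sub_mem (one_mem _) (of_mem_center hz) :
        π ∈ Subalgebra.center R R[G]) b
    -- Modulo `(p, 1 - z)` the claim is the one for the quotient by `z`.
    have h1 : ∀ x ∈ augIdeal R G ^ M, ∃ u w, x = p * u + π * w := by
      have hqpow : ∀ m, ∀ x ∈ augIdeal R G ^ m, q x ∈ augIdeal R (G ⧸ Subgroup.zpowers z) ^ m := by
        intro m
        induction m with
        | zero => intro x _; rw [Submodule.pow_zero, Ideal.one_eq_top]; trivial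
        | succ m ihm =>
          intro x hx
          rw [Ideal.IsTwoSided.pow_succ] at hx ⊢
          refine Submodule.mul_induction_on hx (fun a ha b hb => ?_) fun a b ha hb => ?_
          · rw [map_mul]
            refine Ideal.mul_mem_mul ?_ (ihm b hb)
            rw [mem_augIdeal] at ha ⊢
            rw [aug_mapDomainRingHom, ha]
          · rw [map_add]
            exact add_mem ha hb
      intro x hx
      have h2 := hM (hqpow M x hx)
      rw [← pow_one (p : R[G ⧸ Subgroup.zpowers z]), mem_span_natCast_pow] at h2
      obtain ⟨r, hr⟩ := h2
      obtain ⟨u, rfl⟩ := hq r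
      obtain ⟨w, hw⟩ := exists_mul_of_mapDomain_quotient_eq_zero (R := R) (x := x - p * u) hz
        (QuotientGroup.mk' (Subgroup.zpowers z)) (QuotientGroup.ker_mk' _) (by
          rw [map_sub, map_mul, map_natCast, sub_eq_zero]
          rw [pow_one] at hr
          exact hr)
      exact ⟨u, w, by rw [← hw]; abel⟩
    have h2 : ∀ N, ∀ x ∈ augIdeal R G ^ (M * N), ∃ u w, x = p * u + π ^ N * w := by
      intro N
      induction N with
      | zero => exact fun x _ => ⟨0, x, by simp⟩
      | succ N ihN =>
        intro x hx
        rw [mul_add_one, Ideal.IsTwoSided.pow_add] at hx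
        refine Submodule.mul_induction_on hx (fun a ha b hb => ?_) fun a b ha hb => ?_
        · obtain ⟨u, w, rfl⟩ := ihN a ha
          obtain ⟨u', w', rfl⟩ := h1 b hb
          have e : π ^ N * w * (π * w') = π ^ (N + 1) * (w * w') := by
            rw [pow_succ, mul_assoc, ← mul_assoc w, hπc, mul_assoc, mul_assoc]
          have e' : π ^ N * w * (p * u') = p * (π ^ N * w * u') := by
            rw [← mul_assoc, ← (Nat.cast_commute p (π ^ N * w)).eq, mul_assoc]
          refine ⟨u * (p * u' + π * w') + π ^ N * w * u', w * w', ?_⟩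
          rw [add_mul, mul_add (π ^ N * w), e, e', mul_assoc, mul_add (p : R[G])]
          abel
        · obtain ⟨u, w, rfl⟩ := ha
          obtain ⟨u', w', rfl⟩ := hb
          exact ⟨u + u', w + w', by rw [mul_add, mul_add]; abel⟩
    refine ⟨M * p, fun x hx => ?_⟩
    obtain ⟨u, w, rfl⟩ := h2 p x hx
    have hzc := of_mem_center (R := R) hz
    obtain ⟨e, he⟩ := one_sub_pow_prime (B := Subalgebra.center R R[G]) hp
      (z := ⟨MonoidAlgebra.of R G z, hzc⟩)
      (Subtype.ext (by rw [SubmonoidClass.coe_pow, ← map_pow, hzp, map_one]; rfl))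
    have he' := congrArg (Subalgebra.center R R[G]).val he
    simp only [map_mul, map_pow, map_natCast] at he'
    rw [← pow_one (p : R[G]), mem_span_natCast_pow]
    refine ⟨u + π * e * w, ?_⟩
    rw [pow_one, mul_add, ← mul_assoc, ← mul_assoc (p : R[G])]
    congr 2
    exact he'.trans (mul_assoc _ _ _).symm

end AugmentationIdeal

/-! ### Denominators in logarithmic series -/

section Denominators

variable {p : ℕ} {R : Type*} [CommRing R]

/-- `p ^ (m / M)` is divisible by `n p ^ k` for all `1 ≤ n ≤ m`, as soon as `m` is large. -/
lemma exists_pow_div_eq (hp : p.Prime) (hunit : ∀ n : ℕ, n.Coprime p → IsUnit (n : R))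
    {M : ℕ} (hM : M ≠ 0) (k : ℕ) :
    ∃ m₀ : ℕ, ∀ m ≥ m₀, ∀ n : ℕ, n ≠ 0 → n ≤ m → ∃ r : R, (p : R) ^ (m / M) = n * p ^ k * r := by
  refine ⟨16 * M ^ 2 + 2 * M * (k + 1), fun m hm n hn hnm => ?_⟩
  obtain ⟨s, l, hl, rfl⟩ := Nat.exists_eq_pow_mul_and_not_dvd hn p hp.ne_one
  obtain ⟨v, hv⟩ := (hunit l ((hp.coprime_iff_not_dvd.2 hl).symm)).exists_right_inv
  -- `2 ^ s ≤ m` forces `s = O(√m)`, which is small compared with `m / M`.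
  have hs : s + k ≤ m / M := by
    have hl0 : 0 < l := Nat.pos_of_ne_zero (by rintro rfl; simp at hl)
    have h1 : 2 ^ s ≤ m :=
      ((Nat.pow_le_pow_left hp.two_le s).trans (Nat.le_mul_of_pos_right _ hl0)).trans hnm
    have h2 : s ^ 2 ≤ 4 * m := by
      have h3 : s / 2 < 2 ^ (s / 2) := Nat.lt_two_pow_self
      have h4 : s ≤ 2 * 2 ^ (s / 2) := by omega
      calc s ^ 2 ≤ (2 * 2 ^ (s / 2)) ^ 2 := Nat.pow_le_pow_left h4 2
        _ = 4 * 2 ^ (s / 2 * 2) := by rw [mul_pow, ← pow_mul]; norm_num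
        _ ≤ 4 * 2 ^ s := by
          gcongr
          · norm_num
          · omega
        _ ≤ 4 * m := by gcongr
    rw [Nat.le_div_iff_mul_le (Nat.pos_of_ne_zero hM)]
    have h5 : 16 * M ^ 2 ≤ m := le_trans (Nat.le_add_right _ _) hm
    have h6 : 2 * M * (k + 1) ≤ m := le_trans (Nat.le_add_left _ _) hm
    have h7 : 2 * M * s ≤ m := by
      have h8 : (2 * M * s) ^ 2 ≤ m ^ 2 := by
        calc (2 * M * s) ^ 2 = 4 * M ^ 2 * s ^ 2 := by ring
          _ ≤ 4 * M ^ 2 * (4 * m) := by gcongr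
          _ = 16 * M ^ 2 * m := by ring
          _ ≤ m * m := by gcongr
          _ = m ^ 2 := by ring
      exact (Nat.pow_le_pow_iff_left two_ne_zero).1 h8
    have h9 : 2 * ((s + k) * M) ≤ 2 * m := by
      calc 2 * ((s + k) * M) ≤ 2 * M * s + 2 * M * (k + 1) := by
            have : 2 * M * s + 2 * M * (k + 1) = 2 * ((s + k) * M) + 2 * M := by ring
            omega
        _ ≤ 2 * m := by omega
    omega
  obtain ⟨d, hd⟩ := Nat.exists_eq_add_of_le hs
  refine ⟨v * (p : R) ^ d, ?_⟩
  rw [hd]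
  push_cast
  linear_combination -(p : R) ^ (s + k + d) * hv

variable {N : Type*} [Field N] [CharZero N] [Algebra R N]
  {E V : Type*} [AddCommGroup E] [Module R E] [AddCommGroup V] [Module N V]

lemma inv_smul_mem_padicNhd {ι : E →+ V} (hι : ∀ (r : R) b, ι (r • b) = algebraMap R N r • ι b)
    {n j k : ℕ} (hn : n ≠ 0) {r : R} (hr : (p : R) ^ j = n * p ^ k * r) {v : E}
    (hv : v ∈ padicNhd p (⊤ : AddSubgroup E) j) :
    (1 / (n : N)) • ι v ∈ padicNhd p ι.range k := by
  obtain ⟨b, -, rfl⟩ := mem_padicNhd.1 hv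
  refine mem_padicNhd.2 ⟨ι (r • b), ⟨_, rfl⟩, ?_⟩
  have hn' : (n : N) ≠ 0 := Nat.cast_ne_zero.2 hn
  have h1 : (p ^ j • b : E) = ((p : R) ^ j) • b := by
    rw [← Nat.cast_pow, Nat.cast_smul_eq_nsmul]
  rw [h1, hr, hι, hι, smul_smul, ← Nat.cast_smul_eq_nsmul N, smul_smul]
  congr 1
  push_cast [map_mul, map_pow, map_natCast]
  field_simp

variable {A : Type*} [Ring A]

/-- The terms `(1 / n) ι (τ a)` with `a ∈ I ^ m`, `1 ≤ n ≤ m` tend to `0` as `m → ∞`. -/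
lemma eventually_inv_smul_mem (hp : p.Prime) (hunit : ∀ n : ℕ, n.Coprime p → IsUnit (n : R))
    {ι : E →+ V} (hι : ∀ (r : R) b, ι (r • b) = algebraMap R N r • ι b) (τ : A →+ E)
    {I : Ideal A} [I.IsTwoSided] {M : ℕ} (hI : I ^ M ≤ Ideal.span {(p : A)}) (k : ℕ) :
    ∃ m₀ : ℕ, ∀ m ≥ m₀, ∀ n : ℕ, n ≠ 0 → n ≤ m → ∀ a ∈ I ^ m,
      (1 / (n : N)) • ι (τ a) ∈ padicNhd p ι.range k := by
  -- The exponent `M + 1` is nonzero and still satisfies `I ^ (M + 1) ⊆ (p)`.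
  have hI' : I ^ (M + 1) ≤ Ideal.span {(p : A)} := (Ideal.pow_le_pow_right M.le_succ).trans hI
  obtain ⟨m₀, h⟩ := exists_pow_div_eq (R := R) hp hunit M.succ_ne_zero k
  refine ⟨m₀, fun m hm n hn hnm a ha => ?_⟩
  obtain ⟨r, hr⟩ := h m hm n hn hnm
  refine inv_smul_mem_padicNhd hι hn hr
    (map_mem_padicNhd (Λ := ⊤) (Λ' := ⊤) τ (fun _ _ => trivial) (mem_padicNhd_ring.2 ?_))
  exact pow_le_span_natCast_pow hI' (Nat.mul_div_le m (M + 1)) ha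

end Denominators

/-! ### The logarithmic series attached to the trace `λ` -/

section LogSums

variable {p : ℕ} {R : Type*} [CommRing R] {G : Type*} [Group G]
  {N : Type*} [Field N] [Algebra R N]

lemma toFrac_smul (r : R) (a : R[G]) : toFrac N (r • a) = algebraMap R N r • toFrac N a := by
  ext g
  simp [toFrac, Algebra.smul_def]

lemma toFracClass_smul (r : R) (a : ConjClasses G →₀ R) :
    toFracClass N (r • a) = algebraMap R N r • toFracClass N a := by
  ext g
  simp [toFracClass]

lemma toFracClass_single (c : ConjClasses G) (r : R) :
    toFracClass N (Finsupp.single c r) = Finsupp.single c (algebraMap R N r) := by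
  simp [toFracClass]

lemma toFrac_single (g : G) (r : R) :
    toFrac N (MonoidAlgebra.single g r) = MonoidAlgebra.single g (algebraMap R N r) := by
  simp [toFrac]

lemma phi_toFrac (a : R[G]) : phi N G (toFrac N a) = toFracClass N (phi R G a) := by
  induction a using MonoidAlgebra.induction_linear with
  | zero => simp
  | add a b ha hb => simp only [map_add, ha, hb]
  | single g r => rw [toFrac_single, phi_single, phi_single, toFracClass_single]

lemma toFrac_injective [IsDomain R] [IsFractionRing R N] :
    Function.Injective (toFrac N : R[G] →+* N[G]) :=
  MonoidAlgebra.map_injective _ (IsFractionRing.injective R N)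

lemma toFracClass_injective [IsDomain R] [IsFractionRing R N] :
    Function.Injective (toFracClass N : (ConjClasses G →₀ R) →ₗ[R] _) :=
  Finsupp.mapRange_injective _ (map_zero _) (IsFractionRing.injective R N)

lemma hasPadicSum_iff {f : ℕ → N[G]} {s : N[G]} :
    HasPadicSum R p f s ↔ SumsTo p (toFrac N : R[G] →+* N[G]).toAddMonoidHom.range f s := by
  refine forall_congr' fun k => eventually_congr (Eventually.of_forall fun m => ?_)
  rw [mem_padicNhd]
  have h : ∀ r : R[G], toFrac N ((p : R[G]) ^ k * r) = p ^ k • toFrac N r := fun r => by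
    rw [map_mul, map_pow, map_natCast, nsmul_eq_mul, Nat.cast_pow]
  constructor
  · rintro ⟨r, hr⟩
    exact ⟨_, ⟨r, rfl⟩, by rw [hr, h]; rfl⟩
  · rintro ⟨_, ⟨r, rfl⟩, hr⟩
    exact ⟨r, by rw [h]; exact hr.symm⟩

variable (p) in
/-- The trace `λ = p φ - φ ∘ Ψ : R[G] → R[C_G]`; the group logarithm is
`ℒ(1 - x) = - ∑ λ(x ^ n) / n`. -/
def logTrace (F : R →+* R) : R[G] →+ (ConjClasses G →₀ R) :=
  p • (phi R G).toAddMonoidHom - (phi R G).toAddMonoidHom.comp (psi p F)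

lemma logTrace_apply (F : R →+* R) (a : R[G]) :
    logTrace p F a = p • phi R G a - phi R G (psi p F a) := rfl

lemma logTrace_mul_comm (F : R →+* R) (a b : R[G]) :
    logTrace p F (a * b) = logTrace p F (b * a) := by
  rw [logTrace_apply, logTrace_apply, phi_mul_comm, phi_psi_mul_comm]

variable (N p) in
/-- `∑ λ(x ^ n) / n = s` in `N[C_G]`, for the `p`-adic topology defined by `R[C_G]`. In terms of
the group logarithm this says `ℒ(1 - x) = - s`. -/
def HasLogSum (F : R →+* R) (x : R[G]) (s : ConjClasses G →₀ N) : Prop :=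
  SumsTo p (toFracClass N : (ConjClasses G →₀ R) →ₗ[R] _).toAddMonoidHom.range
    (fun n => (1 / ((n + 1 : ℕ) : N)) • toFracClass N (logTrace p F (x ^ (n + 1)))) s

lemma logTerm_eq (x : R[G]) (n : ℕ) :
    logTerm N p x n = (1 / ((n + 1 : ℕ) : N)) • toFrac N (p • x ^ (n + 1)) := by
  rw [logTerm, map_nsmul, ← Nat.cast_smul_eq_nsmul N, smul_smul]
  congr 1
  ring

lemma HasPadicSum.map_phi {f : ℕ → N[G]} {s : N[G]} (h : HasPadicSum R p f s) :
    SumsTo p (toFracClass N : (ConjClasses G →₀ R) →ₗ[R] _).toAddMonoidHom.range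
      (fun n => phi N G (f n)) (phi N G s) := by
  refine (hasPadicSum_iff.1 h).map (phi N G).toAddMonoidHom ?_
  rintro _ ⟨a, rfl⟩
  exact ⟨phi R G a, (phi_toFrac a).symm⟩

/-- Convergence of `∑ (1 / n) ι (τ (x ^ n))` for `x` in the augmentation ideal. -/
lemma exists_sumsTo_inv_smul [CharZero N] [Finite G]
    [IsAdicComplete (Ideal.span {(p : R)}) R] (hp : p.Prime) (hG : IsPGroup p G)
    {E V : Type*} [AddCommGroup E] [Module R E] [AddCommGroup V] [Module N V]
    (hE : PadicComplete E p) {ι : E →+ V} (hinj : Function.Injective ι)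
    (hι : ∀ (r : R) b, ι (r • b) = algebraMap R N r • ι b) (τ : R[G] →+ E) {x : R[G]}
    (hx : x ∈ augIdeal R G) :
    ∃ s, SumsTo p ι.range (fun n => (1 / ((n + 1 : ℕ) : N)) • ι (τ (x ^ (n + 1)))) s := by
  obtain ⟨M, hM⟩ := exists_augIdeal_pow_le R hp _ G hG rfl
  refine exists_sumsTo hE ι hinj fun k => ?_
  obtain ⟨m₀, h⟩ := eventually_inv_smul_mem (R := R) (N := N) hp
    (fun n hn => isUnit_natCast_of_coprime hn) hι τ hM k
  filter_upwards [eventually_ge_atTop m₀] with n hn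
  exact h (n + 1) (hn.trans n.le_succ) (n + 1) n.succ_ne_zero le_rfl _ (Ideal.pow_mem_pow hx _)

variable [IsDomain R] [IsFractionRing R N] [Finite G]
  [IsAdicComplete (Ideal.span {(p : R)}) R]

lemma padicSeparated_frac :
    PadicSeparated p (toFrac N : R[G] →+* N[G]).toAddMonoidHom.range :=
  padicSeparated_range padicSeparated_monoidAlgebra _ toFrac_injective

lemma padicSeparated_fracClass :
    PadicSeparated p (toFracClass N : (ConjClasses G →₀ R) →ₗ[R] _).toAddMonoidHom.range :=
  padicSeparated_range padicSeparated_finsupp _ toFracClass_injective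

lemma HasPadicSum.unique {f : ℕ → N[G]} {s t : N[G]} (hs : HasPadicSum R p f s)
    (ht : HasPadicSum R p f t) : s = t :=
  SumsTo.unique padicSeparated_frac (hasPadicSum_iff.1 hs) (hasPadicSum_iff.1 ht)

lemma HasLogSum.unique {F : R →+* R} {x : R[G]} {s t : ConjClasses G →₀ N}
    (hs : HasLogSum p N F x s) (ht : HasLogSum p N F x t) : s = t :=
  SumsTo.unique padicSeparated_fracClass hs ht

variable [CharZero N]

lemma exists_hasPadicSum_logTerm (hp : p.Prime) (hG : IsPGroup p G) {x : R[G]}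
    (hx : x ∈ augIdeal R G) : ∃ s, HasPadicSum R p (logTerm N p x) s := by
  obtain ⟨s, hs⟩ := exists_sumsTo_inv_smul (N := N) hp hG padicComplete_monoidAlgebra
    (ι := (toFrac N : R[G] →+* N[G]).toAddMonoidHom) toFrac_injective toFrac_smul
    (nsmulAddMonoidHom p) hx
  refine ⟨s, hasPadicSum_iff.2 ?_⟩
  convert hs using 2 with n
  exact logTerm_eq x n

lemma exists_hasPadicSum_psiLogTerm (hp : p.Prime) (hG : IsPGroup p G) (F : R →+* R) {x : R[G]}
    (hx : x ∈ augIdeal R G) : ∃ s, HasPadicSum R p (psiLogTerm N p F x) s := by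
  obtain ⟨s, hs⟩ := exists_sumsTo_inv_smul (N := N) hp hG padicComplete_monoidAlgebra
    (ι := (toFrac N : R[G] →+* N[G]).toAddMonoidHom) toFrac_injective toFrac_smul
    (psi p F) hx
  exact ⟨s, hasPadicSum_iff.2 hs⟩

lemma exists_hasLogSum (hp : p.Prime) (hG : IsPGroup p G) (F : R →+* R) {x : R[G]}
    (hx : x ∈ augIdeal R G) : ∃ s, HasLogSum p N F x s :=
  exists_sumsTo_inv_smul (N := N) hp hG padicComplete_finsupp
    (ι := (toFracClass N : (ConjClasses G →₀ R) →ₗ[R] _).toAddMonoidHom) toFracClass_injective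
    toFracClass_smul (logTrace p F) hx

lemma groupLog_eq_neg (hp : p.Prime) (hG : IsPGroup p G) (F : R →+* R) {a : R[G]}
    (ha : -a ∈ augIdeal R G) {s : ConjClasses G →₀ N} (hs : HasLogSum p N F (-a) s) :
    groupLog N p F (1 + a) = -s := by
  have h1 := exists_hasPadicSum_logTerm (N := N) hp hG ha
  have h2 := exists_hasPadicSum_psiLogTerm (N := N) hp hG F ha
  rw [groupLog, show (1 : R[G]) - (1 + a) = -a by abel, padicSum, padicSum, dif_pos h1, dif_pos h2,
    map_sub]
  congr 1
  refine HasLogSum.unique (F := F) (x := -a) ?_ hs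
  refine (h1.choose_spec.map_phi.sub h2.choose_spec.map_phi).congr fun n => ?_
  rw [logTerm_eq, psiLogTerm, LinearMap.map_smul, LinearMap.map_smul, phi_toFrac, phi_toFrac,
    ← smul_sub, ← map_sub,
    logTrace_apply, map_nsmul]

end LogSums

/-! ### Integrality of the group logarithm -/

section Integrality

variable {p : ℕ} {R : Type*} [CommRing R] {G : Type*} [Group G] [Finite G]
  {N : Type*} [Field N] [CharZero N] [Algebra R N]

/-- The congruence `φ(x ^ (p k)) ≡ φ(Ψ(x ^ k))` modulo `p k`, written with denominators. -/
lemma inv_smul_phi_sub_mem (hp : p.Prime) (hunit : ∀ n : ℕ, n.Coprime p → IsUnit (n : R))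
    (F : R →+* R) (hF : ∀ r : R, F r - r ^ p ∈ Ideal.span {(p : R)}) (x : R[G]) {k : ℕ}
    (hk : k ≠ 0) :
    (1 / (k : N)) • toFracClass N (phi R G (x ^ (p * k)) - phi R G (psi p F (x ^ k))) ∈
      padicNhd p (toFracClass N : (ConjClasses G →₀ R) →ₗ[R] _).toAddMonoidHom.range 1 := by
  obtain ⟨s, l, hl, rfl⟩ := Nat.exists_eq_pow_mul_and_not_dvd hk p hp.ne_one
  obtain ⟨v, hv⟩ := (hunit l ((hp.coprime_iff_not_dvd.2 hl).symm)).exists_right_inv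
  have h := phi_pow_sub_phi_psi_mem hp F hF (x ^ l) s
  rw [← pow_mul, ← pow_mul, show l * p ^ (s + 1) = p * (p ^ s * l) by ring,
    show l * p ^ s = p ^ s * l by ring] at h
  refine inv_smul_mem_padicNhd (r := v)
    (ι := (toFracClass N : (ConjClasses G →₀ R) →ₗ[R] _).toAddMonoidHom)
    toFracClass_smul hk ?_ h
  push_cast
  linear_combination -(p : R) ^ (s + 1) * hv

/-- The sum `∑ λ(x ^ n) / n` lies in `p R[C_G]`: the terms of `∑ p φ(x ^ n) / n` whose exponent is
prime to `p` are in `p R[C_G]`, and the others are matched with those of `∑ φ(Ψ(x ^ n)) / n`. -/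
lemma HasLogSum.exists_eq [IsDomain R] [IsFractionRing R N]
    [IsAdicComplete (Ideal.span {(p : R)}) R] (hp : p.Prime) (hG : IsPGroup p G)
    {F : R →+* R} (hF : ∀ r : R, F r - r ^ p ∈ Ideal.span {(p : R)}) {x : R[G]}
    (hx : x ∈ augIdeal R G) {s : ConjClasses G →₀ N} (hs : HasLogSum p N F x s) :
    ∃ t : ConjClasses G →₀ R, s = toFracClass N ((p : R) • t) := by
  have hunit : ∀ n : ℕ, n.Coprime p → IsUnit (n : R) := fun n hn => isUnit_natCast_of_coprime hn
  set ι := (toFracClass N : (ConjClasses G →₀ R) →ₗ[R] _).toAddMonoidHom with hι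
  obtain ⟨s₁, h₁⟩ := exists_sumsTo_inv_smul (N := N) hp hG padicComplete_finsupp
    (ι := ι) toFracClass_injective toFracClass_smul (p • (phi R G).toAddMonoidHom) hx
  obtain ⟨s₂, h₂⟩ := exists_sumsTo_inv_smul (N := N) hp hG padicComplete_finsupp
    (ι := ι) toFracClass_injective toFracClass_smul
    ((phi R G).toAddMonoidHom.comp (psi p F)) hx
  have hs12 : s = s₁ - s₂ := by
    refine hs.unique ?_
    refine (h₁.sub h₂).congr fun n => ?_
    rw [← smul_sub, ← map_sub]
    rfl
  set a : ℕ → (ConjClasses G →₀ N) := fun n =>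
    (1 / ((n + 1 : ℕ) : N)) • ι ((p • (phi R G).toAddMonoidHom) (x ^ (n + 1))) with ha
  set b : ℕ → (ConjClasses G →₀ N) := fun n =>
    (1 / ((n + 1 : ℕ) : N)) • ι (((phi R G).toAddMonoidHom.comp (psi p F)) (x ^ (n + 1))) with hb
  have hterm : ∀ n, (n + 1).Coprime p → a n ∈ padicNhd p ι.range 1 := by
    intro n hn
    obtain ⟨v, hv⟩ := (hunit _ hn).exists_right_inv
    exact inv_smul_mem_padicNhd (r := v) toFracClass_smul n.succ_ne_zero
      (j := 1) (by linear_combination -(p : R) ^ 1 * hv)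
      (mem_padicNhd.2 ⟨phi R G (x ^ (n + 1)), trivial, by rw [pow_one]; rfl⟩)
  have hmult : ∀ K q, p = q + 1 → a (p * K + q) - b K ∈ padicNhd p ι.range 1 := by
    intro K q hq
    have h := inv_smul_phi_sub_mem (N := N) hp hunit F hF x K.succ_ne_zero
    convert h using 1
    have e : p * K + q + 1 = p * (K + 1) := by rw [hq]; ring
    have hp0 : (p : N) ≠ 0 := Nat.cast_ne_zero.2 hp.ne_zero
    simp only [ha, hb]
    rw [e, map_sub, smul_sub]
    congr 1
    change (1 / ((p * (K + 1) : ℕ) : N)) • ι (p • phi R G (x ^ (p * (K + 1)))) = _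
    rw [map_nsmul, ← Nat.cast_smul_eq_nsmul N, smul_smul]
    congr 1
    push_cast
    field_simp
  have hpart : ∀ K, (∑ n ∈ Finset.range (p * K), a n) - (∑ n ∈ Finset.range K, b n) ∈
      padicNhd p ι.range 1 := by
    obtain ⟨q, hq⟩ := Nat.exists_eq_succ_of_ne_zero hp.ne_zero
    intro K
    induction K with
    | zero => simp [zero_mem]
    | succ K ih =>
      have e : p * (K + 1) = p * K + q + 1 := by rw [hq, Nat.succ_eq_add_one]; ring
      rw [e, Finset.sum_range_succ, Finset.sum_range_succ, Finset.sum_range_add,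
        add_assoc, add_sub_add_comm, add_sub_assoc]
      refine add_mem ih (add_mem (sum_mem fun i hi => hterm _ ?_) (hmult K q hq))
      rw [Finset.mem_range] at hi
      rw [Nat.coprime_comm, hp.coprime_iff_not_dvd, add_assoc, ← Nat.dvd_add_iff_right ⟨K, rfl⟩]
      exact Nat.not_dvd_of_pos_of_lt i.succ_pos (by omega)
  have htend : Tendsto (fun K => p * K) atTop atTop :=
    tendsto_id.const_mul_atTop' hp.pos
  obtain ⟨K, e1, e2⟩ := ((htend.eventually (h₁ 1)).and (h₂ 1)).exists
  have hmem : s ∈ padicNhd p ι.range 1 := by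
    have := add_mem (sub_mem (hpart K) e1) e2
    rw [hs12]
    convert this using 1
    abel
  obtain ⟨_, ⟨t, rfl⟩, ht⟩ := mem_padicNhd.1 hmem
  refine ⟨t, ?_⟩
  rw [← ht, pow_one, ← map_nsmul, Nat.cast_smul_eq_nsmul]
  rfl

end Integrality

/-! ### The group logarithm is a homomorphism -/

section Additivity

open Polynomial

lemma coeff_logPoly_pow_mem {A : Type*} [Ring A] (I : Ideal A) [I.IsTwoSided] {x y : A}
    (hx : x ∈ I) (hy : y ∈ I) (n m : ℕ) : (logPoly x y ^ n).coeff m ∈ I ^ m := by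
  induction n generalizing m with
  | zero =>
    rw [pow_zero, coeff_one]
    split_ifs with h
    · rw [h, Submodule.pow_zero, Ideal.one_eq_top]; trivial
    · exact zero_mem _
  | succ n ih =>
    have e : ∀ P : A[X], P * logPoly x y =
        P * C x * X + P * C y * X - P * C (x * y) * X * X := fun P => by
      rw [logPoly, mul_sub, mul_add, pow_two]
      simp only [mul_assoc]
    rw [pow_succ, e]
    match m with
    | 0 => rw [Submodule.pow_zero, Ideal.one_eq_top]; trivial
    | 1 =>
      rw [coeff_sub, coeff_add, coeff_mul_X, coeff_mul_X, coeff_mul_X, coeff_mul_X_zero,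
        coeff_mul_C, coeff_mul_C, sub_zero, Submodule.pow_one]
      exact add_mem (I.mul_mem_left _ hx) (I.mul_mem_left _ hy)
    | m + 2 =>
      rw [coeff_sub, coeff_add, coeff_mul_X, coeff_mul_X, coeff_mul_X, coeff_mul_X,
        coeff_mul_C, coeff_mul_C, coeff_mul_C]
      have h1 : ∀ z ∈ I, (logPoly x y ^ n).coeff (m + 1) * z ∈ I ^ (m + 2) := fun z hz => by
        rw [show m + 2 = m + 1 + 1 from rfl, Ideal.IsTwoSided.pow_add (m + 1) 1, Submodule.pow_one]
        exact Ideal.mul_mem_mul (ih _) hz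
      have h2 : (logPoly x y ^ n).coeff m * (x * y) ∈ I ^ (m + 2) := by
        rw [Ideal.IsTwoSided.pow_add m 2, Ideal.IsTwoSided.pow_succ 1, Submodule.pow_one]
        exact Ideal.mul_mem_mul (ih _) (Ideal.mul_mem_mul hx hy)
      exact sub_mem (add_mem (h1 x hx) (h1 y hy)) h2

/-- The value at `t = 1` of `(1 - (1 - t x) (1 - t y)) ^ (n + 1)`, as a sum of coefficients. -/
lemma sum_coeff_logPoly_pow {A : Type*} [Ring A] (x y : A) {n K : ℕ} (h : n < K) :
    ∑ m ∈ Finset.range (K + K), (logPoly x y ^ (n + 1)).coeff (m + 1) =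
      (x + y - x * y) ^ (n + 1) := by
  let ev : A[X] →+* A := eval₂RingHom' (RingHom.id A) 1 fun a => Commute.one_right _
  have h1 : ev (logPoly x y) = x + y - x * y := by
    simp [ev, logPoly]
  have hdeg : (logPoly x y).natDegree ≤ 2 := by
    unfold logPoly
    compute_degree
  have hdeg' : (logPoly x y ^ (n + 1)).natDegree < K + K + 1 := by
    have := natDegree_pow_le_of_le (n + 1) hdeg
    omega
  have h0 : (logPoly x y ^ (n + 1)).coeff 0 = 0 := by
    rw [pow_succ, logPoly_eq, X_mul, ← mul_assoc, coeff_mul_X_zero]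
  rw [← h1, ← map_pow]
  change _ = eval₂ (RingHom.id A) 1 _
  rw [eval₂_eq_sum_range' _ hdeg', Finset.sum_range_succ']
  simp [h0]

variable {p : ℕ} {R : Type*} [CommRing R] {G : Type*} [Group G] [Finite G]
  {N : Type*} [Field N] [CharZero N] [Algebra R N]

/-- The group logarithm is a homomorphism: `(1 - x) (1 - y) = 1 - (x + y - x y)`. The identity
holds coefficientwise in `t` after replacing `x`, `y` by `t x`, `t y`, and the rearrangement of
the series at `t = 1` is harmless because the `m`-th coefficient lies in the `m`-th power of the
augmentation ideal, with denominators at most `m`. -/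
lemma HasLogSum.mul [IsAdicComplete (Ideal.span {(p : R)}) R] (hp : p.Prime) (hG : IsPGroup p G)
    {F : R →+* R} {x y : R[G]} (hx : x ∈ augIdeal R G) (hy : y ∈ augIdeal R G)
    {s t : ConjClasses G →₀ N} (hs : HasLogSum p N F x s) (ht : HasLogSum p N F y t) :
    HasLogSum p N F (x + y - x * y) (s + t) := by
  have hunit : ∀ n : ℕ, n.Coprime p → IsUnit (n : R) := fun n hn => isUnit_natCast_of_coprime hn
  set ι := (toFracClass N : (ConjClasses G →₀ R) →ₗ[R] _).toAddMonoidHom with hι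
  let T : R[G] →+ (ConjClasses G →₀ N) := ι.comp (logTrace p F)
  have hT : ∀ a b, T (a * b) = T (b * a) := fun a b => congrArg ι (logTrace_mul_comm F a b)
  obtain ⟨M, hM⟩ := exists_augIdeal_pow_le R hp _ G hG rfl
  refine SumsTo.of_partialSum_sub (SumsTo.add hs ht) fun k => ?_
  obtain ⟨m₀, hm₀⟩ := eventually_inv_smul_mem (N := N) hp hunit (ι := ι) toFracClass_smul
    (logTrace p F) hM k
  filter_upwards [eventually_ge_atTop m₀] with K hK
  have e1 : ∀ n ∈ Finset.range K,
      (1 / ((n + 1 : ℕ) : N)) • T ((x + y - x * y) ^ (n + 1)) =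
        ∑ m ∈ Finset.range (K + K),
          (1 / ((n + 1 : ℕ) : N)) • T ((logPoly x y ^ (n + 1)).coeff (m + 1)) := by
    intro n hn
    rw [← sum_coeff_logPoly_pow x y (Finset.mem_range.1 hn), map_sum, Finset.smul_sum]
  have e2 : ∀ m ∈ Finset.range K,
      (1 / ((m + 1 : ℕ) : N)) • T (x ^ (m + 1)) + (1 / ((m + 1 : ℕ) : N)) • T (y ^ (m + 1)) =
        ∑ n ∈ Finset.range K,
          (1 / ((n + 1 : ℕ) : N)) • T ((logPoly x y ^ (n + 1)).coeff (m + 1)) := by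
    intro m hm
    rw [trace_log_mul T hT (Finset.mem_range.1 hm), smul_add]
  change (∑ n ∈ Finset.range K, (1 / ((n + 1 : ℕ) : N)) • T ((x + y - x * y) ^ (n + 1))) -
    (∑ m ∈ Finset.range K, ((1 / ((m + 1 : ℕ) : N)) • T (x ^ (m + 1)) +
      (1 / ((m + 1 : ℕ) : N)) • T (y ^ (m + 1)))) ∈ _
  rw [Finset.sum_congr rfl e1, Finset.sum_congr rfl e2, Finset.sum_comm (s := Finset.range K)
    (t := Finset.range (K + K)), Finset.sum_range_add, add_sub_cancel_left]
  refine sum_mem fun i _ => sum_mem fun n hn => ?_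
  have hn' := Finset.mem_range.1 hn
  exact hm₀ (K + i + 1) (by omega) (n + 1) n.succ_ne_zero (by omega) _
    (coeff_logPoly_pow_mem _ hx hy _ _)

end Additivity

/-! ### Functoriality in the group -/

section Naturality

variable {p : ℕ} {R : Type*} [CommRing R] {G H : Type*} [Group G] [Group H]
  {N : Type*} [Field N] [Algebra R N]

lemma phi_mapDomainRingHom (f : G →* H) (a : R[G]) :
    phi R H (MonoidAlgebra.mapDomainRingHom R f a) =
      Finsupp.mapDomain (ConjClasses.map f) (phi R G a) := by
  induction a using MonoidAlgebra.induction_linear with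
  | zero => simp
  | add a b ha hb => simp only [map_add, ha, hb, Finsupp.mapDomain_add]
  | single g r =>
    rw [mapDomainRingHom_single, phi_single, phi_single, Finsupp.mapDomain_single]
    rfl

lemma psi_mapDomainRingHom (F : R →+* R) (f : G →* H) (a : R[G]) :
    psi p F (MonoidAlgebra.mapDomainRingHom R f a) =
      MonoidAlgebra.mapDomainRingHom R f (psi p F a) := by
  induction a using MonoidAlgebra.induction_linear with
  | zero => simp
  | add a b ha hb => simp only [map_add, ha, hb]
  | single g r =>
    rw [mapDomainRingHom_single, psi_single, psi_single, mapDomainRingHom_single, map_pow]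

lemma logTrace_mapDomainRingHom (F : R →+* R) (f : G →* H) (a : R[G]) :
    logTrace p F (MonoidAlgebra.mapDomainRingHom R f a) =
      Finsupp.mapDomain (ConjClasses.map f) (logTrace p F a) := by
  change _ = Finsupp.mapDomain.addMonoidHom (ConjClasses.map f) _
  rw [logTrace_apply, logTrace_apply, map_sub, map_nsmul, psi_mapDomainRingHom,
    phi_mapDomainRingHom, phi_mapDomainRingHom]
  rfl

lemma toFracClass_mapDomain (f : G →* H) (a : ConjClasses G →₀ R) :
    toFracClass N (Finsupp.mapDomain (ConjClasses.map f) a) =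
      Finsupp.mapDomain (ConjClasses.map f) (toFracClass N a) := by
  induction a using Finsupp.induction_linear with
  | zero => simp
  | add a b ha hb => simp only [map_add, ha, hb, Finsupp.mapDomain_add]
  | single c r => simp only [Finsupp.mapDomain_single, toFracClass_single]

lemma HasLogSum.mapDomain {F : R →+* R} {x : R[G]} {s : ConjClasses G →₀ N}
    (h : HasLogSum p N F x s) (f : G →* H) :
    HasLogSum p N F (MonoidAlgebra.mapDomainRingHom R f x)
      (Finsupp.mapDomain (ConjClasses.map f) s) := by
  have h1 := SumsTo.map (Λ' := (toFracClass N : (ConjClasses H →₀ R) →ₗ[R] _).toAddMonoidHom.range)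
    h (Finsupp.lmapDomain N N (ConjClasses.map f)).toAddMonoidHom (by
      rintro _ ⟨a, rfl⟩
      exact ⟨Finsupp.mapDomain (ConjClasses.map f) a, toFracClass_mapDomain f a⟩)
  refine h1.congr fun n => ?_
  rw [← map_pow, logTrace_mapDomainRingHom, toFracClass_mapDomain]
  exact LinearMap.map_smul (Finsupp.lmapDomain N N (ConjClasses.map f)) _ _

/-- A homomorphism to a commutative group kills `𝒜(R[G])`. -/
lemma mapDomainRingHom_eq_zero_of_mem_abKernel {B : Type*} [CommGroup B] (f : G →* B) {x : R[G]}
    (hx : x ∈ abKernel R G) : MonoidAlgebra.mapDomainRingHom R f x = 0 := by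
  have e : (Abelianization.lift f).comp Abelianization.of = f := by ext; simp
  rw [← e, MonoidAlgebra.mapDomainRingHom_comp, RingHom.comp_apply, show _ = _ from hx, map_zero]

lemma abKernel_eq_zero_of_comm (hcomm : ∀ g h : G, g * h = h * g) {x : R[G]}
    (hx : x ∈ abKernel R G) : x = 0 := by
  let _ : CommGroup G := { (inferInstance : Group G) with mul_comm := hcomm }
  have h := mapDomainRingHom_eq_zero_of_mem_abKernel (MonoidHom.id G) hx
  rwa [MonoidAlgebra.mapDomainRingHom_id, RingHom.id_apply] at h

open scoped commutatorElement in
lemma one_sub_of_commutator_mem (a b : G) : 1 - MonoidAlgebra.of R G ⁅a, b⁆ ∈ abKernel R G := by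
  change MonoidAlgebra.mapDomainRingHom R Abelianization.of _ = 0
  rw [map_sub, map_one, MonoidAlgebra.of_apply, mapDomainRingHom_single, map_commutatorElement,
    commutatorElement_eq_one_iff_mul_comm.2 (mul_comm _ _), sub_eq_zero]
  rfl

lemma phi_injective_of_commGroup (B : Type*) [CommGroup B] : Function.Injective (phi R B) := by
  have h : Function.Injective (ConjClasses.mk : B → ConjClasses B) := fun a b hab =>
    isConj_iff_eq.1 (ConjClasses.mk_eq_mk_iff_isConj.1 hab)
  intro a b hab
  exact MonoidAlgebra.coeff_injective (Finsupp.mapDomain_injective h hab)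

end Naturality

/-! ### The logarithm near a central element of order `p` -/

section CentralElements

variable {p : ℕ} {R : Type*} [CommRing R] {G : Type*} [Group G]
  {N : Type*} [Field N] [CharZero N] [Algebra R N]

/-- `Ψ` kills the ideal generated by `1 - z` because `(z g) ^ p = g ^ p`. -/
lemma psi_one_sub_mul (F : R →+* R) {z : G} (hz : z ∈ Subgroup.center G) (hzp : z ^ p = 1)
    (a : R[G]) : psi p F ((1 - MonoidAlgebra.of R G z) * a) = 0 := by
  induction a using MonoidAlgebra.induction_linear with
  | zero => simp
  | add a b ha hb => rw [mul_add, map_add, ha, hb, add_zero]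
  | single g r =>
    have hc : Commute z g := (Subgroup.mem_center_iff.1 hz g).symm
    rw [sub_mul, one_mul, MonoidAlgebra.of_apply, MonoidAlgebra.single_mul_single, map_sub,
      psi_single, psi_single, hc.mul_pow, hzp, one_mul, one_mul, sub_self]

lemma logTrace_one_sub_mul (F : R →+* R) {z : G} (hz : z ∈ Subgroup.center G) (hzp : z ^ p = 1)
    (a : R[G]) : logTrace p F ((1 - MonoidAlgebra.of R G z) * a) =
      p • phi R G ((1 - MonoidAlgebra.of R G z) * a) := by
  rw [logTrace_apply, psi_one_sub_mul F hz hzp, map_zero, sub_zero]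

lemma exists_one_sub_pow_eq [IsAdicComplete (Ideal.span {(p : R)}) R] (hp : p.Prime) {z : G}
    (hz : z ∈ Subgroup.center G) (hzp : z ^ p = 1) :
    ∃ c : ℕ → R[G], c 0 = 1 ∧ ∀ n, (1 - MonoidAlgebra.of R G z) ^ (n + 1) =
      ((n + 1 : ℕ) : R[G]) * ((1 - MonoidAlgebra.of R G z) * c n) := by
  have hunit : ∀ n : ℕ, n.Coprime p → IsUnit (n : R) := fun n hn => isUnit_natCast_of_coprime hn
  have hzc : MonoidAlgebra.of R G z ∈ Subalgebra.center R R[G] := of_mem_center hz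
  have hzp' : (MonoidAlgebra.of R G z) ^ p = 1 := by rw [← map_pow, hzp, map_one]
  have hex : ∀ n : ℕ, ∃ c : R[G], (n = 0 → c = 1) ∧ (1 - MonoidAlgebra.of R G z) ^ (n + 1) =
      ((n + 1 : ℕ) : R[G]) * ((1 - MonoidAlgebra.of R G z) * c) := by
    intro n
    rcases eq_or_ne n 0 with rfl | hn
    · exact ⟨1, fun _ => rfl, by simp⟩
    · obtain ⟨c, -, h⟩ := one_sub_pow_eq_of_mem_center (R := R) (A := R[G]) hp hunit hzc hzp'
        n.succ_ne_zero
      exact ⟨c, fun h0 => absurd h0 hn, h⟩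
  choose c hc0 hc using hex
  exact ⟨c, hc0 0 rfl, hc⟩

lemma mul_one_sub_of_comm {z : G} (hz : z ∈ Subgroup.center G) (b : R[G]) :
    b * (1 - MonoidAlgebra.of R G z) = (1 - MonoidAlgebra.of R G z) * b := by
  rw [mul_sub, sub_mul, mul_one, one_mul, Subalgebra.mem_center_iff.1 (of_mem_center hz) b]

/-- For a central `z` with `z ^ p = 1`, every element `p φ((1 - z) v)` with `v` in the augmentation
ideal is a value `- ℒ(1 - (1 - z) x)`. -/
lemma exists_hasLogSum_one_sub_mul [Finite G] [IsAdicComplete (Ideal.span {(p : R)}) R]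
    (hp : p.Prime) (hG : IsPGroup p G) (F : R →+* R) {z : G} (hz : z ∈ Subgroup.center G)
    (hzp : z ^ p = 1) {v : R[G]} (hv : v ∈ augIdeal R G) :
    ∃ x ∈ augIdeal R G, HasLogSum p N F ((1 - MonoidAlgebra.of R G z) * x)
      (toFracClass N ((p : R) • phi R G ((1 - MonoidAlgebra.of R G z) * v))) := by
  obtain ⟨M, hM⟩ := exists_augIdeal_pow_le R hp _ G hG rfl
  obtain ⟨c, hc0, hc⟩ := exists_one_sub_pow_eq (R := R) hp hz hzp
  have hsep : PadicSeparated p (⊤ : AddSubgroup R[G]) := padicSeparated_monoidAlgebra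
  have hcomp : PadicComplete R[G] p := padicComplete_monoidAlgebra
  obtain ⟨x, hx, hsum⟩ := exists_powerSeries_eq hsep hcomp (augIdeal R G) hM
    (augIdeal_closed (p := p)) c hc0 hv
  refine ⟨x, hx, ?_⟩
  let T : R[G] →+ (ConjClasses G →₀ N) :=
    ((toFracClass N : (ConjClasses G →₀ R) →ₗ[R] _).toAddMonoidHom.comp
      (p • (phi R G).toAddMonoidHom)).comp (AddMonoidHom.mulLeft (1 - MonoidAlgebra.of R G z))
  have hT : ∀ a, T a =
      toFracClass N (p • phi R G ((1 - MonoidAlgebra.of R G z) * a)) := fun a => rfl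
  have h1 := hsum.map (Λ' := (toFracClass N : (ConjClasses G →₀ R) →ₗ[R] _).toAddMonoidHom.range)
    T fun a _ => ⟨p • phi R G ((1 - MonoidAlgebra.of R G z) * a), rfl⟩
  rw [hT, ← Nat.cast_smul_eq_nsmul R] at h1
  refine h1.congr fun n => ?_
  have e : ((1 - MonoidAlgebra.of R G z) * x) ^ (n + 1) =
      (1 - MonoidAlgebra.of R G z) * ((n + 1) • (c n * x ^ (n + 1))) := by
    rw [(show Commute _ x from (mul_one_sub_of_comm hz x).symm).mul_pow, hc, mul_smul_comm,
      nsmul_eq_mul, mul_assoc, mul_assoc]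
  have hn : ((n + 1 : ℕ) : N) ≠ 0 := Nat.cast_ne_zero.2 n.succ_ne_zero
  rw [hT, e, logTrace_one_sub_mul F hz hzp, mul_smul_comm, map_nsmul (phi R G), smul_comm p,
    map_nsmul (toFracClass N) (n + 1), ← Nat.cast_smul_eq_nsmul N (n + 1), smul_smul,
    one_div_mul_cancel hn, one_smul]

open scoped commutatorElement in
/-- If `z = ⁅a, b⁆` is central, then `φ((1 - z) b a) = 0`, so that in `φ((1 - z) w)` the element
`w` may be modified to have augmentation zero. -/
lemma exists_mem_augIdeal_phi_eq (a b : G) (w : R[G]) :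
    ∃ v ∈ augIdeal R G, phi R G ((1 - MonoidAlgebra.of R G ⁅a, b⁆) * v) =
      phi R G ((1 - MonoidAlgebra.of R G ⁅a, b⁆) * w) := by
  refine ⟨w - MonoidAlgebra.single (b * a) (aug R G w), ?_, ?_⟩
  · rw [mem_augIdeal, map_sub, aug_single, sub_self]
  · have e : ⁅a, b⁆ * (b * a) = a * b := by rw [commutatorElement_def]; group
    rw [mul_sub, map_sub, sub_eq_self, sub_mul, one_mul, MonoidAlgebra.of_apply,
      MonoidAlgebra.single_mul_single, e, one_mul, map_sub, phi_single, phi_single,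
      conjClasses_mk_mul_comm, sub_self]

end CentralElements

/-! ### The image of `1 + 𝒜(R[G])` -/

section Surjectivity

variable {p : ℕ} {R : Type*} [CommRing R] [IsDomain R] {N : Type*} [Field N] [CharZero N]
  [Algebra R N] [IsFractionRing R N]

lemma natCast_smul_toFracClass_inj (hp : p.Prime) {G : Type*} [Group G]
    {s t : ConjClasses G →₀ R}
    (h : toFracClass N ((p : R) • s) = toFracClass N ((p : R) • t)) : s = t := by
  have hpN : algebraMap R N (p : R) ≠ 0 := by
    rw [map_natCast]
    exact Nat.cast_ne_zero.2 hp.ne_zero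
  rw [toFracClass_smul, toFracClass_smul] at h
  exact toFracClass_injective (smul_right_injective _ hpN h)

variable [IsAdicComplete (Ideal.span {(p : R)}) R]

open scoped commutatorElement in
/-- Every element of `p φ(𝒜(R[G]))` is a value `- ℒ(1 - x)` with `x ∈ 𝒜(R[G])`. Induction on the
order of `G`: for a central commutator `z` of order `p` the claim for `G ⧸ ⟨z⟩` solves the problem
up to an element of `p φ((1 - z) R[G])`, which is removed by multiplying `1 - x` by a suitable
`1 - (1 - z) q`. -/
lemma exists_hasLogSum_eq_phi (hp : p.Prime) {F : R →+* R}
    (hF : ∀ r : R, F r - r ^ p ∈ Ideal.span {(p : R)}) :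
    ∀ (n : ℕ) (G : Type*) [Group G] [Finite G], IsPGroup p G → Nat.card G = n →
      ∀ y ∈ abKernel R G, ∃ x ∈ abKernel R G,
        HasLogSum p N F x (toFracClass N ((p : R) • phi R G y)) := by
  have := Fact.mk hp
  intro n
  induction n using Nat.strong_induction_on with
  | _ n ih =>
    intro G _ _ hG hn y hy
    by_cases hcomm : ∀ g h : G, g * h = h * g
    · rw [abKernel_eq_zero_of_comm hcomm hy]
      refine ⟨0, zero_mem _, ?_⟩
      simpa [HasLogSum] using sumsTo_zero
    push Not at hcomm
    obtain ⟨a, b, hz, hz1, hzp⟩ := exists_commutator_mem_center hG hcomm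
    have hπA := one_sub_of_commutator_mem (R := R) a b
    have hφ := exists_mem_augIdeal_phi_eq (R := R) a b
    have hzof : Abelianization.of ⁅a, b⁆ = 1 := by
      rw [map_commutatorElement, commutatorElement_eq_one_iff_mul_comm.2 (mul_comm _ _)]
    set z := ⁅a, b⁆ with hzdef
    have hnormal := normal_zpowers_of_mem_center hz
    let f := QuotientGroup.mk' (Subgroup.zpowers z)
    have hf : Function.Surjective f := QuotientGroup.mk'_surjective _
    let q := MonoidAlgebra.mapDomainRingHom R f
    -- Solve the problem modulo `z`, and lift.
    have hqy : q y ∈ abKernel R (G ⧸ Subgroup.zpowers z) := by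
      change MonoidAlgebra.mapDomainRingHom R Abelianization.of (q y) = 0
      rw [← RingHom.comp_apply, ← MonoidAlgebra.mapDomainRingHom_comp]
      exact mapDomainRingHom_eq_zero_of_mem_abKernel _ hy
    obtain ⟨x', hx', hsum'⟩ := ih _ (hn ▸ card_quotient_zpowers_lt hz1) (G ⧸ Subgroup.zpowers z)
      (hG.to_quotient _) rfl _ hqy
    obtain ⟨x, rfl⟩ := mapDomainRingHom_surjective (R := R) hf x'
    have hx : x ∈ abKernel R G := by
      let g : G ⧸ Subgroup.zpowers z →* Abelianization G :=
        QuotientGroup.lift _ Abelianization.of fun h hh => by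
          obtain ⟨i, rfl⟩ := hh
          exact zpow_mem (MonoidHom.mem_ker.2 hzof) i
      have e : Abelianization.of = g.comp f := by ext h; rfl
      change MonoidAlgebra.mapDomainRingHom R Abelianization.of x = 0
      rw [e, MonoidAlgebra.mapDomainRingHom_comp, RingHom.comp_apply]
      exact mapDomainRingHom_eq_zero_of_mem_abKernel g hx'
    have hxI := abKernel_le_augIdeal hx
    obtain ⟨s, hs⟩ := exists_hasLogSum (N := N) hp hG F hxI
    obtain ⟨t, rfl⟩ := hs.exists_eq hp hG hF hxI
    -- The error is in `φ((1 - z) R[G])`, and even in `φ((1 - z) I)`.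
    have ht : Finsupp.mapDomain (ConjClasses.map f) (t - phi R G y) = 0 := by
      have h1 := (hs.mapDomain f).unique hsum'
      rw [← toFracClass_mapDomain, Finsupp.mapDomain_smul] at h1
      have h2 := natCast_smul_toFracClass_inj hp h1
      change Finsupp.lmapDomain R R (ConjClasses.map f) _ = 0
      rw [map_sub, sub_eq_zero]
      exact h2.trans (phi_mapDomainRingHom f y)
    obtain ⟨w, hw⟩ := exists_phi_mul_of_mapDomain_eq_zero hz f hf (QuotientGroup.ker_mk' _) ht
    obtain ⟨v, hv, hvw⟩ := hφ w
    obtain ⟨u, hu, husum⟩ := exists_hasLogSum_one_sub_mul (N := N) hp hG F hz hzp (neg_mem hv)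
    refine ⟨x + (1 - MonoidAlgebra.of R G z) * u - x * ((1 - MonoidAlgebra.of R G z) * u), ?_, ?_⟩
    · have h1 : (1 - MonoidAlgebra.of R G z) * u ∈ abKernel R G := by
        have : (abKernel R G).IsTwoSided := inferInstanceAs (RingHom.ker _).IsTwoSided
        exact Ideal.mul_mem_right _ _ hπA
      exact sub_mem (add_mem hx h1) (Ideal.mul_mem_left _ _ h1)
    · have h := HasLogSum.mul hp hG hxI (Ideal.mul_mem_left _ _ hu) hs husum
      convert h using 1
      rw [← map_add, ← smul_add, mul_neg, map_neg, hvw, ← hw]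
      congr 2
      abel

/-- The sum `∑ λ(x ^ n) / n` of an element of `𝒜(R[G])` lies in `p φ(𝒜(R[G]))`: it lies in
`p R[C_G]` and vanishes in the group ring of the abelianization. -/
lemma HasLogSum.exists_mem_abKernel (hp : p.Prime) {G : Type*} [Group G] [Finite G]
    (hG : IsPGroup p G) {F : R →+* R} (hF : ∀ r : R, F r - r ^ p ∈ Ideal.span {(p : R)})
    {x : R[G]} (hx : x ∈ abKernel R G) {s : ConjClasses G →₀ N} (hs : HasLogSum p N F x s) :
    ∃ y ∈ abKernel R G, s = toFracClass N ((p : R) • phi R G y) := by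
  obtain ⟨t, rfl⟩ := hs.exists_eq hp hG hF (abKernel_le_augIdeal hx)
  obtain ⟨y, rfl⟩ := phi_surjective t
  refine ⟨y, ?_, rfl⟩
  have : Finite (Abelianization G) := inferInstanceAs (Finite (G ⧸ commutator G))
  have h0 : HasLogSum p N F (0 : R[Abelianization G]) (toFracClass N ((p : R) • (0 : _ →₀ R))) := by
    simpa [HasLogSum] using sumsTo_zero
  have h1 := hs.mapDomain Abelianization.of
  rw [show MonoidAlgebra.mapDomainRingHom R Abelianization.of x = 0 from hx] at h1
  have h2 := h1.unique h0
  rw [← toFracClass_mapDomain, Finsupp.mapDomain_smul, ← phi_mapDomainRingHom] at h2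
  have h3 := natCast_smul_toFracClass_inj hp h2
  exact phi_injective_of_commGroup (Abelianization G) (h3.trans (map_zero _).symm)

end Surjectivity

end GroupLog

end

theorem theorem3p5 (p : ℕ) (hp : p.Prime)
    (R : Type*) [CommRing R] [IsDomain R] [IsAddTorsionFree R]
    [IsAdicComplete (Ideal.span {(p : R)}) R]
    (F : R →+* R) (hF : ∀ r : R, F r - r ^ p ∈ Ideal.span {(p : R)})
    (N : Type*) [Field N] [Algebra R N] [IsFractionRing R N]
    (G : Type*) [Group G] [Finite G] (hG : IsPGroup p G) :
    (∀ x ∈ GroupLog.augIdeal R G,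
      (∃! s, GroupLog.HasPadicSum R p (GroupLog.logTerm N p x) s) ∧
      (∃! s, GroupLog.HasPadicSum R p (GroupLog.psiLogTerm N p F x) s)) ∧
    (fun a : MonoidAlgebra R G => GroupLog.groupLog N p F (1 + a)) ''
        (GroupLog.abKernel R G : Set (MonoidAlgebra R G)) =
      (fun a : MonoidAlgebra R G =>
        GroupLog.toFracClass N ((p : R) • GroupLog.phi R G a)) ''
        (GroupLog.abKernel R G : Set (MonoidAlgebra R G)) := by
  have : CharZero R := CharZero.of_isAddTorsionFree R R
  have : CharZero N := charZero_of_injective_algebraMap (IsFractionRing.injective R N)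
  refine ⟨fun x hx => ⟨?_, ?_⟩, ?_⟩
  · obtain ⟨s, hs⟩ := GroupLog.exists_hasPadicSum_logTerm (N := N) hp hG hx
    exact ⟨s, hs, fun t ht => ht.unique hs⟩
  · obtain ⟨s, hs⟩ := GroupLog.exists_hasPadicSum_psiLogTerm (N := N) hp hG F hx
    exact ⟨s, hs, fun t ht => ht.unique hs⟩
  · apply Set.Subset.antisymm
    · rintro _ ⟨a, ha, rfl⟩
      have ha' : -a ∈ GroupLog.abKernel R G := neg_mem ha
      have haI := GroupLog.abKernel_le_augIdeal ha'
      obtain ⟨s, hs⟩ := GroupLog.exists_hasLogSum (N := N) hp hG F haI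
      obtain ⟨y, hy, rfl⟩ := hs.exists_mem_abKernel hp hG hF ha'
      refine ⟨-y, neg_mem hy, ?_⟩
      simp only
      rw [GroupLog.groupLog_eq_neg hp hG F haI hs, map_neg, smul_neg, map_neg]
    · rintro _ ⟨y, hy, rfl⟩
      obtain ⟨x, hx, hs⟩ := GroupLog.exists_hasLogSum_eq_phi (N := N) hp hF _ G hG rfl _
        (neg_mem hy)
      rw [← neg_neg x] at hs
      refine ⟨-x, neg_mem hx, ?_⟩
      simp only
      rw [GroupLog.groupLog_eq_neg hp hG F
        (by rw [neg_neg]; exact GroupLog.abKernel_le_augIdeal hx) hs, map_neg, smul_neg, map_neg,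
        neg_neg]
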